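/- Let $\{A_{ij}\}_{i,j\ge1}$ and $\{B_{ij}\}_{i,j\ge1}$ be two arrays of real random variables of standard type: within each array the entries are independent and identically distributed, with mean $0$, variance $1$ and finite sixth moment (the laws of $A_{11}$ and $B_{11}$ may differ). Let $\sigma>0$ and $\alpha>0$, let $m=m_n$ be nonnegative integers with $m_n/n\to\alpha$ as $n\to\infty$ (for example $m=\alpha n$, along those $n$ for which this is an integer), and put $\mathbf A_n=(A_{ij})_{1\le i\le m,\,1\le j\le n}$ and $\mathbf B_n=(B_{ij})_{1\le i\le m,\,1\le j\le n}$. For $\gamma>0$ and $n\ge\gamma$ let $\mathbf A_n^\gamma$ be the sparsification of $\mathbf A_n$: independently for each entry, and independently of $\mathbf A_n$, the entry $A_{ij}$ is kept with probability $\gamma/n$ and replaced by $0$ with probability $1-\gamma/n$. For an $m\times n$ real matrix $H$ let $$C_n(H)=\frac1{2n}\sum_{i=1}^n\log\Big(1+\frac{1}{\sigma^2}\lambda_i(H^{\top}H)\Big),$$ where $\lambda_1(H^\top H),\dots,\lambda_n(H^\top H)$ are the eigenvalues of $H^\top H$ with multiplicity. Then the random variables $C_n(\gamma^{-1/2}\mathbf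 A_n^\gamma)$ and $C_n(n^{-1/2}\mathbf B_n)$ are integrable, for every $\gamma>0$ the limit $$L(\gamma)=\lim_{n\to\infty}\big\{\mathbb E[C_n(\gamma^{-1/2}\mathbf A_n^\gamma)]-\mathbb E[C_n(n^{-1/2}\mathbf B_n)]\big\}$$ exists and is finite, and $\lim_{\gamma\to\infty}L(\gamma)=0$. -/

import Mathlib

open MeasureTheory ProbabilityTheory Filter Topology

/-- An infinite array of real random variables is of standard type: independent, identically
distributed, centred, of unit variance and with finite (uniformly bounded) sixth moment. -/
structure IsStandardType {Ω : Type*} [MeasurableSpace Ω] (P : Measure Ω)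
    (A : ℕ → ℕ → Ω → ℝ) : Prop where
  measurable : ∀ i j, Measurable (A i j)
  indep : iIndepFun (fun q : ℕ × ℕ => A q.1 q.2) P
  identDistrib : ∀ i j k l, IdentDistrib (A i j) (A k l) P P
  mean : ∀ i j, ∫ ω, A i j ω ∂P = 0
  second_moment : ∀ i j, ∫ ω, A i j ω ^ 2 ∂P = 1
  sixth_moment : ∃ K : ℝ, ∀ i j,
    Integrable (fun ω => A i j ω ^ 6) P ∧ ∫ ω, A i j ω ^ 6 ∂P ≤ K

/-- The random `m × n` matrix formed by the upper left corner of an infinite array. -/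
def corner {Ω : Type*} (A : ℕ → ℕ → Ω → ℝ) (m n : ℕ) (ω : Ω) : Matrix (Fin m) (Fin n) ℝ :=
  Matrix.of fun i j => A i j ω

/-- `S` is obtained from the random matrix `A` by keeping each entry with probability `p` and
replacing it by `0` with probability `1 - p`, independently over the entries and independently
of `A`; `χ i j` tells whether the entry `(i, j)` is kept. -/
def IsSparsification {Ω : Type*} [MeasurableSpace Ω] (P : Measure Ω) {m n : ℕ} (p : ℝ)
    (A S : Ω → Matrix (Fin m) (Fin n) ℝ) : Prop :=
  ∃ χ : Fin m → Fin n → Ω → Bool,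
    (∀ i j, Measurable (χ i j)) ∧
    (∀ i j, P.real {ω | χ i j ω = true} = p) ∧
    iIndepFun (fun q : Fin m × Fin n => χ q.1 q.2) P ∧
    IndepFun (fun ω (q : Fin m × Fin n) => A ω q.1 q.2)
      (fun ω (q : Fin m × Fin n) => χ q.1 q.2 ω) P ∧
    ∀ ω i j, S ω i j = if χ i j ω = true then A ω i j else 0

/-- The MIMO rate `(1 / 2n) ∑ log (1 + λᵢ(Hᵀ H) / σ²)`, the sum running over the `n` eigenvalues
of `Hᵀ H`, counted with multiplicity. -/
noncomputable def mimoRate {m n : ℕ} (σ : ℝ) (H : Matrix (Fin m) (Fin n) ℝ) : ℝ :=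
  1 / (2 * (n : ℝ)) *
    ∑ i, Real.log (1 + 1 / σ ^ 2 *
      (show (H.transpose * H).IsHermitian from
        Matrix.isHermitian_conjTranspose_mul_self H).eigenvalues i)

/-! ### Log-determinants and the rate -/

section LinearAlgebra

open Matrix

/-! The dense matrix is the sparse model at `γ = n` (keep probability one), so everything reduces to
one family of masked arrays, controlled uniformly over `γ ≥ γ₀`.

Truncation. By concavity of `log det`, the rate is stable in the normalized Frobenius norm, with
constants independent of the matrices (`abs_mimoRate_sub_le`). Entries can thus be replaced by
bounded ones, still centred with unit variance, at a small cost uniform in `γ` and `n`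
(`exists_bounded_standardization`).

Moments. The expected trace of `(Hᵀ H) ^ (k + 1)` is a sum over closed walks in a complete bipartite
graph, grouped by kernel (coincidence pattern). A walk with `E` distinct edges carries the weight `γ
^ E / γ ^ (k + 1)`, and it visits at most `E + 1` vertices, so the normalized counts converge.
Centring kills walks that use an edge only once, hence `E ≤ k + 1`. As `γ → ∞` only walks using each
edge exactly twice survive, with weight one whatever the entry law; the same happens at `γ = n`.
Hence both models share their limiting moments (`modelMoment_limits`).

From moments to the logarithm. The moment bound has the form `C ^ (k + 1) * (2 * (k + 1))!`. In
terms of singular values `s` this bounds the expectation of `cosh (c * s)` for small `c`. It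
therefore suffices that `log (1 + s ^ 2 / σ ^ 2)` is a limit of polynomials in `s ^ 2` for the
weight `cosh (c * s)` (`coshApproximable_log_one_add`). No convergence of spectral laws is needed:
the difference of expected rates is uniformly close to a combination of moments whose iterated limit
is zero, and `exists_iterated_limit` concludes. -/

theorem Matrix.IsHermitian.trace_pow_eq_sum {n : Type*} [Fintype n] [DecidableEq n]
    {A : Matrix n n ℝ} (hA : A.IsHermitian) (k : ℕ) :
    (A ^ k).trace = ∑ i, hA.eigenvalues i ^ k := by
  conv_lhs => rw [hA.spectral_theorem, ← map_pow, Unitary.conjStarAlgAut_apply,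
    trace_mul_cycle, Unitary.coe_star_mul_self, one_mul, diagonal_pow, trace_diagonal]
  simp

theorem Matrix.IsHermitian.det_one_add_smul {n : Type*} [Fintype n] [DecidableEq n]
    {A : Matrix n n ℝ} (hA : A.IsHermitian) (c : ℝ) :
    (1 + c • A).det = ∏ i, (1 + c * hA.eigenvalues i) := by
  have h : 1 + c • A = Unitary.conjStarAlgAut ℝ _ hA.eigenvectorUnitary
      (1 + c • diagonal (RCLike.ofReal ∘ hA.eigenvalues)) := by
    conv_lhs => rw [hA.spectral_theorem]
    rw [map_add, map_one, map_smul]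
  rw [h, Unitary.conjStarAlgAut_apply, det_mul_comm, ← mul_assoc, Unitary.coe_star_mul_self,
    one_mul, ← diagonal_one, ← diagonal_smul, diagonal_add, det_diagonal]
  simp

theorem Matrix.PosDef.log_det_le_trace {n : Type*} [Fintype n] [DecidableEq n]
    {A : Matrix n n ℝ} (hA : A.PosDef) :
    Real.log A.det ≤ A.trace - Fintype.card n := by
  have h1 := hA.isHermitian.trace_pow_eq_sum 1
  have h2 := hA.isHermitian.det_eq_prod_eigenvalues
  simp only [pow_one] at h1
  rw [h1, h2, Real.log_prod (fun i _ => by simpa using (hA.eigenvalues_pos i).ne')]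
  calc _ ≤ ∑ i, (hA.isHermitian.eigenvalues i - 1) :=
        Finset.sum_le_sum fun i _ => Real.log_le_sub_one_of_pos (hA.eigenvalues_pos i)
    _ = _ := by simp

open scoped MatrixOrder in
theorem Matrix.PosSemidef.exists_eq_transpose_mul_self {n : Type*} [Fintype n] [DecidableEq n]
    {A : Matrix n n ℝ} (hA : A.PosSemidef) : ∃ W : Matrix n n ℝ, A = Wᵀ * W := by
  obtain ⟨B, hB⟩ := CStarAlgebra.nonneg_iff_eq_star_mul_self.mp hA.nonneg
  exact ⟨B, by simpa [star_eq_conjTranspose] using hB⟩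

/-- Concavity of `log det`: its graph lies below the tangent at `Y`. Writing `Y⁻¹ = Wᵀ * W` and
passing to `W * X * Wᵀ` reduces to the tangent at the identity. -/
theorem Matrix.PosDef.log_det_sub_le {n : Type*} [Fintype n] [DecidableEq n]
    {X Y : Matrix n n ℝ} (hX : X.PosDef) (hY : Y.PosDef) :
    Real.log X.det - Real.log Y.det ≤ (Y⁻¹ * (X - Y)).trace := by
  obtain ⟨W, hW⟩ := hY.inv.posSemidef.exists_eq_transpose_mul_self
  have hdY : Y.det ≠ 0 := hY.det_pos.ne'
  have hdet : Y.det⁻¹ = W.det * W.det := by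
    have := congrArg det hW
    rwa [det_nonsing_inv, Ring.inverse_eq_inv', det_mul, det_transpose] at this
  have hdW : W.det ≠ 0 := by
    intro h
    simp [h, hdY] at hdet
  have hWu : IsUnit W := (isUnit_iff_isUnit_det W).2 (isUnit_iff_ne_zero.2 hdW)
  have hM : (W * X * Wᵀ).PosDef := by
    have := hX.mul_mul_conjTranspose_same (B := W) (vecMul_injective_of_isUnit hWu)
    simpa using this
  have h := hM.log_det_le_trace
  have e1 : (W * X * Wᵀ).det = Y.det⁻¹ * X.det := by
    rw [det_mul, det_mul, det_transpose, hdet]; ring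
  have e2 : (W * X * Wᵀ).trace = (Y⁻¹ * X).trace := by
    rw [trace_mul_cycle, ← hW]
  rw [e1, e2, Real.log_mul (inv_ne_zero hdY) hX.det_pos.ne', Real.log_inv] at h
  have e3 : (Y⁻¹ * (X - Y)).trace = (Y⁻¹ * X).trace - Fintype.card n := by
    rw [Matrix.mul_sub, trace_sub, nonsing_inv_mul _ (isUnit_iff_ne_zero.2 hdY), trace_one]
  rw [e3]
  linarith

theorem Matrix.trace_transpose_mul_le {m n : Type*} [Fintype m] [Fintype n]
    (A B : Matrix m n ℝ) {θ : ℝ} (hθ : 0 < θ) :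
    2 * (Aᵀ * B).trace ≤ θ * (Aᵀ * A).trace + (1 / θ) * (Bᵀ * B).trace := by
  simp only [trace, diag_apply, mul_apply, transpose_apply, Finset.mul_sum]
  rw [← Finset.sum_add_distrib]
  refine Finset.sum_le_sum fun i _ => ?_
  rw [← Finset.sum_add_distrib]
  refine Finset.sum_le_sum fun j _ => ?_
  have h : 0 ≤ (1 / θ) * (θ * A j i - B j i) ^ 2 := by positivity
  have e : (1 / θ) * (θ * A j i - B j i) ^ 2
      = θ * (A j i * A j i) + (1 / θ) * (B j i * B j i) - 2 * (A j i * B j i) := by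
    field_simp
    ring
  linarith

theorem Matrix.trace_transpose_mul_self {m n : Type*} [Fintype m] [Fintype n]
    (A : Matrix m n ℝ) : (Aᵀ * A).trace = ∑ i, ∑ j, A i j ^ 2 := by
  simp only [trace, diag_apply, mul_apply, transpose_apply]
  rw [Finset.sum_comm]
  simp [sq]

theorem Matrix.posSemidef_transpose_mul_self {m n : Type*} [Fintype m] [Fintype n]
    (A : Matrix m n ℝ) : (Aᵀ * A).PosSemidef := by
  simpa using posSemidef_conjTranspose_mul_self A

theorem Matrix.posDef_one_add_smul {m n : Type*} [Fintype m] [Fintype n] [DecidableEq n]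
    (G : Matrix m n ℝ) {c : ℝ} (hc : 0 ≤ c) : (1 + c • (Gᵀ * G)).PosDef :=
  PosDef.one.add_posSemidef ((posSemidef_transpose_mul_self G).smul hc)

/-- With `D = H - G` and `R = Y⁻¹`, the tangent bound has a quadratic part, handled by `R ≤ 1`, and
a cross part, handled by Young's inequality. The bound is free of the size of `G` because the
resolvent absorbs it: `c * tr ((G R)ᵀ (G R)) = tr (R - R²) ≤ n`. -/
theorem Matrix.log_det_one_add_sub_le {m n : Type*} [Fintype m] [Fintype n] [DecidableEq n]
    (H G : Matrix m n ℝ) {c θ : ℝ} (hc : 0 < c) (hθ : 0 < θ) :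
    Real.log (1 + c • (Hᵀ * H)).det - Real.log (1 + c • (Gᵀ * G)).det ≤
      θ * Fintype.card n + c * (1 + 1 / θ) * ∑ i, ∑ j, (H i j - G i j) ^ 2 := by
  set Y := 1 + c • (Gᵀ * G) with hYd
  have hY : Y.PosDef := posDef_one_add_smul G hc.le
  have hdY : IsUnit Y.det := isUnit_iff_ne_zero.2 hY.det_pos.ne'
  refine ((posDef_one_add_smul H hc.le).log_det_sub_le hY).trans ?_
  set D := H - G with hD
  set R := Y⁻¹ with hR
  have hRY : R * Y = 1 := nonsing_inv_mul _ hdY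
  have hYR : Y * R = 1 := mul_nonsing_inv _ hdY
  have hRt : Rᵀ = R := (conjTranspose_eq_transpose_of_trivial R).symm.trans hY.inv.isHermitian.eq
  have hGG : c • (Gᵀ * G) = Y - 1 := by simp [hYd]
  have hRp : R.PosSemidef := hY.inv.posSemidef
  have hfro : ∑ i, ∑ j, (H i j - G i j) ^ 2 = (Dᵀ * D).trace := by
    rw [trace_transpose_mul_self]; rfl
  have hsub : 1 + c • (Hᵀ * H) - Y = c • (Gᵀ * D + Dᵀ * G + Dᵀ * D) := by
    have : H = G + D := by simp [hD]
    rw [this, hYd, transpose_add, ← sub_eq_zero]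
    simp only [Matrix.mul_add, Matrix.add_mul, smul_add]
    abel
  have hsym : (R * (Dᵀ * G)).trace = (R * (Gᵀ * D)).trace := by
    rw [← trace_transpose (R * (Dᵀ * G)), transpose_mul, transpose_mul, transpose_transpose, hRt,
      trace_mul_comm]
  -- the two quadratic forms controlling the increment
  have hR1 : (R * R).trace ≥ 0 := by
    have := (posSemidef_transpose_mul_self R).trace_nonneg
    rwa [hRt] at this
  have hRn : R.trace ≤ Fintype.card n := by
    have h : 0 ≤ (c • (G * R * Gᵀ)).trace := by
      have := (hRp.mul_mul_conjTranspose_same G).trace_nonneg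
      rw [trace_smul, smul_eq_mul]
      exact mul_nonneg hc.le (by simpa using this)
    have e : (c • (G * R * Gᵀ)).trace = Fintype.card n - R.trace := by
      rw [trace_smul, trace_mul_cycle, ← trace_smul, ← smul_mul, hGG, Matrix.sub_mul, hYR,
        trace_sub, Matrix.one_mul, trace_one]
    linarith
  have hGR : c * ((G * R)ᵀ * (G * R)).trace ≤ Fintype.card n := by
    have e : c • ((G * R)ᵀ * (G * R)) = R - R * R := by
      rw [transpose_mul, hRt]
      calc c • (R * Gᵀ * (G * R)) = R * (c • (Gᵀ * G)) * R := by
            simp only [Matrix.mul_smul, Matrix.smul_mul, Matrix.mul_assoc]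
        _ = R - R * R := by
            rw [hGG, Matrix.mul_sub, hRY, Matrix.sub_mul]; simp
    have := congrArg trace e
    rw [trace_smul, smul_eq_mul, trace_sub] at this
    linarith
  have hDD : (R * (Dᵀ * D)).trace ≤ (Dᵀ * D).trace := by
    -- `1 - R = R * ((Y - 1) + (Y - 1) ^ 2) * R`, a congruence of a positive semidefinite matrix.
    have hp : (1 - R).PosSemidef := by
      have h1 : (c • (Gᵀ * G) + (c • (Gᵀ * G))ᵀ * (c • (Gᵀ * G))).PosSemidef :=
        ((posSemidef_transpose_mul_self G).smul hc.le).add (posSemidef_transpose_mul_self _)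
      have h2 := h1.mul_mul_conjTranspose_same R
      have h3 : (c • (Gᵀ * G))ᵀ = c • (Gᵀ * G) := by simp
      rw [h3, hGG, conjTranspose_eq_transpose_of_trivial, hRt] at h2
      convert! h2 using 1
      have e : Y - 1 + (Y - 1) * (Y - 1) = Y * Y - Y := by noncomm_ring
      rw [e, Matrix.mul_sub, Matrix.sub_mul, hRY, Matrix.one_mul, ← Matrix.mul_assoc, hRY,
        Matrix.one_mul, hYR]
    have h := (hp.mul_mul_conjTranspose_same D).trace_nonneg
    rw [conjTranspose_eq_transpose_of_trivial, trace_mul_cycle, trace_mul_comm, Matrix.sub_mul,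
      Matrix.one_mul, trace_sub] at h
    linarith
  have hcross : 2 * ((G * R)ᵀ * D).trace ≤
      (c⁻¹ * θ) * (c * ((G * R)ᵀ * (G * R)).trace) + 1 / θ * (Dᵀ * D).trace := by
    have := trace_transpose_mul_le (G * R) D hθ
    rwa [show (c⁻¹ * θ) * (c * ((G * R)ᵀ * (G * R)).trace) = θ * ((G * R)ᵀ * (G * R)).trace by
      field_simp]
  have e1 : ((G * R)ᵀ * D).trace = (R * (Gᵀ * D)).trace := by
    rw [transpose_mul, hRt, Matrix.mul_assoc]
  rw [hsub, Matrix.mul_smul, trace_smul, smul_eq_mul, Matrix.mul_add, Matrix.mul_add, trace_add,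
    trace_add, hsym, hfro]
  have h5 : c * (2 * ((G * R)ᵀ * D).trace) ≤ θ * Fintype.card n + c * (1 / θ * (Dᵀ * D).trace) := by
    calc _ ≤ c * ((c⁻¹ * θ) * (c * ((G * R)ᵀ * (G * R)).trace) + 1 / θ * (Dᵀ * D).trace) :=
          mul_le_mul_of_nonneg_left hcross hc.le
      _ = θ * (c * ((G * R)ᵀ * (G * R)).trace) + c * (1 / θ * (Dᵀ * D).trace) := by
          field_simp
      _ ≤ _ := by gcongr
  rw [e1] at h5
  nlinarith [mul_le_mul_of_nonneg_left hDD hc.le]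

end LinearAlgebra

/-! ### Stability and integrability of the rate -/

section Rate

open Matrix

variable {m n : ℕ} {σ : ℝ}

theorem mimoRate_eq_log_det (hσ : 0 < σ) (H : Matrix (Fin m) (Fin n) ℝ) :
    mimoRate σ H = 1 / (2 * (n : ℝ)) * Real.log (1 + (1 / σ ^ 2) • (Hᵀ * H)).det := by
  have hH : (Hᵀ * H).IsHermitian := isHermitian_conjTranspose_mul_self H
  have h0 : ∀ i, 0 ≤ hH.eigenvalues i := (posSemidef_transpose_mul_self H).eigenvalues_nonneg
  rw [mimoRate, hH.det_one_add_smul, Real.log_prod]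
  intro i _
  have := mul_nonneg (by positivity : (0 : ℝ) ≤ 1 / σ ^ 2) (h0 i)
  positivity

theorem abs_mimoRate_sub_le (hσ : 0 < σ) {θ : ℝ} (hθ : 0 < θ) (H G : Matrix (Fin m) (Fin n) ℝ) :
    |mimoRate σ H - mimoRate σ G| ≤
      θ / 2 + (1 + 1 / θ) / (2 * σ ^ 2) * (1 / (n : ℝ) * ∑ i, ∑ j, (H i j - G i j) ^ 2) := by
  have key : ∀ H G : Matrix (Fin m) (Fin n) ℝ, mimoRate σ H - mimoRate σ G ≤
      θ / 2 + (1 + 1 / θ) / (2 * σ ^ 2) * (1 / (n : ℝ) * ∑ i, ∑ j, (H i j - G i j) ^ 2) := by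
    intro H G
    have h := log_det_one_add_sub_le H G (c := 1 / σ ^ 2) (by positivity) hθ
    rw [mimoRate_eq_log_det hσ, mimoRate_eq_log_det hσ, ← mul_sub]
    -- Only an inequality: for `n = 0` division by zero makes the left side vanish.
    have hn : (1 / (2 * (n : ℝ))) * (θ * n) ≤ θ / 2 := by
      rcases Nat.eq_zero_or_pos n with rfl | hn
      · simp; positivity
      · have : (0 : ℝ) < n := by exact_mod_cast hn
        apply le_of_eq; field_simp
    refine (mul_le_mul_of_nonneg_left h (by positivity)).trans ?_
    rw [Fintype.card_fin, mul_add]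
    refine add_le_add hn (le_of_eq ?_)
    rw [one_div, one_div, one_div (n : ℝ), mul_inv]
    field_simp
  rw [abs_le]
  refine ⟨?_, key H G⟩
  have h := key G H
  have e : ∑ i, ∑ j, (G i j - H i j) ^ 2 = ∑ i, ∑ j, (H i j - G i j) ^ 2 := by
    refine Finset.sum_congr rfl fun i _ => Finset.sum_congr rfl fun j _ => by ring
  rw [e] at h
  linarith

theorem mimoRate_zero : mimoRate σ (0 : Matrix (Fin m) (Fin n) ℝ) = 0 := by
  have h0 : (0 : Matrix (Fin m) (Fin n) ℝ)ᵀ * (0 : Matrix (Fin m) (Fin n) ℝ) = 0 := by simp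
  have h : ∀ (A : Matrix (Fin n) (Fin n) ℝ) (hA : A.IsHermitian), A = 0 →
      ∀ i, hA.eigenvalues i = 0 := by
    rintro A hA rfl i
    exact congrFun (hA.eigenvalues_eq_zero_iff.2 rfl) i
  rw [mimoRate, Finset.sum_eq_zero, mul_zero]
  intro i _
  rw [h _ _ h0]; simp

theorem measurable_mimoRate (hσ : 0 < σ) {Ω : Type*} [MeasurableSpace Ω]
    {H : Ω → Matrix (Fin m) (Fin n) ℝ} (hH : ∀ i j, Measurable fun ω => H ω i j) :
    Measurable fun ω => mimoRate σ (H ω) := by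
  simp only [mimoRate_eq_log_det hσ]
  refine Measurable.const_mul (Real.measurable_log.comp ?_) _
  simp only [det_apply, Matrix.add_apply, Matrix.smul_apply, mul_apply, transpose_apply]
  refine Finset.measurable_sum _ fun p _ => Measurable.const_smul
    (Finset.measurable_prod _ fun i _ => ?_) _
  have h : Measurable fun ω => ∑ j, H ω j (p i) * H ω j i :=
    Finset.measurable_sum _ fun k _ => (hH _ _).mul (hH _ _)
  exact measurable_const.add (h.const_smul (1 / σ ^ 2))

theorem integrable_mimoRate (hσ : 0 < σ) {Ω : Type*} [MeasurableSpace Ω] {P : Measure Ω}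
    [IsFiniteMeasure P] {H : Ω → Matrix (Fin m) (Fin n) ℝ}
    (hH : ∀ i j, Measurable fun ω => H ω i j) (hH2 : ∀ i j, Integrable (fun ω => H ω i j ^ 2) P) :
    Integrable (fun ω => mimoRate σ (H ω)) P := by
  -- The dominating function is the stability bound at `θ = 1`, comparing with the zero matrix.
  have hg : Integrable (fun ω => 1 / 2 + (1 + 1 / 1) / (2 * σ ^ 2) *
      (1 / (n : ℝ) * ∑ i, ∑ j, H ω i j ^ 2)) P :=
    (integrable_const _).add (((integrable_finsetSum _ fun i _ =>
      integrable_finsetSum _ fun j _ => hH2 i j).const_mul _).const_mul _)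
  refine hg.mono' (measurable_mimoRate hσ hH).aestronglyMeasurable (ae_of_all _ fun ω => ?_)
  have := abs_mimoRate_sub_le hσ one_pos (H ω) 0
  rw [mimoRate_zero, sub_zero] at this
  simpa using this

end Rate

/-! ### Weighted polynomial approximation of even functions -/

section WeightedApproximation

/-- Even functions on the line that are limits of polynomials in `s ^ 2` for the weight
`cosh (c * s)`. -/
def CoshApproximable (c : ℝ) (g : ℝ → ℝ) : Prop :=
  ∀ ε > 0, ∃ p : Polynomial ℝ, ∀ s, |g s - p.eval (s ^ 2)| ≤ ε * Real.cosh (c * s)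

namespace CoshApproximable

variable {c : ℝ} {f g : ℝ → ℝ}

theorem of_polynomial (p : Polynomial ℝ) : CoshApproximable c fun s => p.eval (s ^ 2) := by
  intro ε hε
  refine ⟨p, fun s => ?_⟩
  rw [sub_self, abs_zero]
  have := Real.cosh_pos (c * s)
  positivity

theorem add (hf : CoshApproximable c f) (hg : CoshApproximable c g) :
    CoshApproximable c fun s => f s + g s := by
  intro ε hε
  obtain ⟨p, hp⟩ := hf (ε / 2) (by positivity)
  obtain ⟨q, hq⟩ := hg (ε / 2) (by positivity)
  refine ⟨p + q, fun s => ?_⟩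
  rw [Polynomial.eval_add, add_sub_add_comm]
  refine (abs_add_le _ _).trans ?_
  linarith [hp s, hq s]

theorem const_mul (hf : CoshApproximable c f) (a : ℝ) : CoshApproximable c fun s => a * f s := by
  intro ε hε
  obtain ⟨p, hp⟩ := hf (ε / (|a| + 1)) (by positivity)
  refine ⟨Polynomial.C a * p, fun s => ?_⟩
  rw [Polynomial.eval_mul, Polynomial.eval_C, ← mul_sub, abs_mul]
  have h1 := mul_le_mul_of_nonneg_left (hp s) (abs_nonneg a)
  refine h1.trans ?_
  rw [← mul_assoc]
  refine mul_le_mul_of_nonneg_right ?_ (Real.cosh_pos _).le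
  rw [mul_div_assoc', div_le_iff₀ (by positivity)]
  nlinarith [abs_nonneg a]

theorem sum {ι : Type*} (t : Finset ι) {F : ι → ℝ → ℝ} (hF : ∀ i ∈ t, CoshApproximable c (F i)) :
    CoshApproximable c fun s => ∑ i ∈ t, F i s := by
  classical
  induction t using Finset.induction_on with
  | empty => simpa using of_polynomial (c := c) 0
  | insert a t ha ih =>
    simp only [Finset.sum_insert ha]
    exact (hF a (by simp)).add (ih fun i hi => hF i (by simp [hi]))

theorem of_approx (h : ∀ ε > 0, ∃ g, CoshApproximable c g ∧
    ∀ s, |f s - g s| ≤ ε * Real.cosh (c * s)) : CoshApproximable c f := by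
  intro ε hε
  obtain ⟨g, hg, hfg⟩ := h (ε / 2) (by positivity)
  obtain ⟨p, hp⟩ := hg (ε / 2) (by positivity)
  refine ⟨p, fun s => ?_⟩
  have := abs_sub_le (f s) (g s) (p.eval (s ^ 2))
  linarith [hp s, hfg s]

end CoshApproximable

theorem Real.sq_cosh_half_le (x : ℝ) : Real.cosh (x / 2) * Real.cosh (x / 2) ≤ Real.cosh x := by
  have h : Real.cosh x = Real.cosh (x / 2) ^ 2 + Real.sinh (x / 2) ^ 2 := by
    rw [← Real.cosh_two_mul]; ring_nf
  nlinarith [sq_nonneg (Real.sinh (x / 2))]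

theorem Real.hasSum_cosh_even (x : ℝ) :
    HasSum (fun k : ℕ => x ^ (2 * k) / ((2 * k).factorial : ℝ)) (Real.cosh x) :=
  Real.hasSum_cosh x

theorem Real.pow_two_mul_le_cosh (x : ℝ) (k : ℕ) :
    x ^ (2 * k) ≤ (2 * k).factorial * Real.cosh x := by
  have h := (Real.hasSum_cosh_even x).summable.le_tsum k fun j _ =>
    div_nonneg (by rw [pow_mul]; positivity) (by positivity)
  rw [(Real.hasSum_cosh_even x).tsum_eq, div_le_iff₀ (by positivity)] at h
  linarith

/-- Truncation error of the cosine series, in terms of `cosh` at the doubled argument. -/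
theorem Real.abs_cos_sub_sum_le (x : ℝ) (N : ℕ) :
    |Real.cos x - ∑ l ∈ Finset.range N, (-1) ^ l * x ^ (2 * l) / ((2 * l).factorial : ℝ)| ≤
      (1 / 4) ^ N * Real.cosh (2 * x) := by
  have hc := Real.hasSum_cos x
  have htail := (hasSum_nat_add_iff' N).2 hc
  have hs := ((hasSum_nat_add_iff' N).2 (Real.hasSum_cosh_even (2 * x))).mul_left ((1 / 4 : ℝ) ^ N)
  -- Doubling the argument multiplies the term of degree `2 * (l + N)` by `4 ^ (l + N) ≥ 4 ^ N`,
  -- which pays for the factor `(1 / 4) ^ N`.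
  have hle : ∀ l, ‖(-1 : ℝ) ^ (l + N) * x ^ (2 * (l + N)) / ((2 * (l + N)).factorial : ℝ)‖ ≤
      (1 / 4) ^ N * ((2 * x) ^ (2 * (l + N)) / ((2 * (l + N)).factorial : ℝ)) := by
    intro l
    have hx : 0 ≤ x ^ (2 * (l + N)) := by rw [pow_mul]; positivity
    rw [norm_div, norm_mul, norm_pow, norm_neg, norm_one, one_pow, one_mul, Real.norm_of_nonneg hx,
      Real.norm_of_nonneg (by positivity), mul_div_assoc']
    gcongr
    rw [mul_pow, pow_mul (2 : ℝ), ← mul_assoc, pow_add]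
    have : (1 : ℝ) ≤ (1 / 4) ^ N * ((2 ^ 2) ^ l * (2 ^ 2) ^ N) := by
      rw [mul_left_comm, ← mul_pow]
      norm_num
      exact one_le_pow₀ (by norm_num)
    nlinarith
  have h := tsum_of_norm_bounded hs hle
  rw [htail.tsum_eq, Real.norm_eq_abs] at h
  refine h.trans (mul_le_mul_of_nonneg_left ?_ (by positivity))
  rw [sub_le_self_iff]
  exact Finset.sum_nonneg fun k _ => div_nonneg (by rw [pow_mul]; positivity) (by positivity)

/-- Induction on `j`, replacing a single cosine by its Taylor polynomial and bounding the others by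
one; this is why the condition on `τ` does not depend on `j`. Half of the exponent `c` pays for the
monomial and half for the Taylor error, the halves being recombined by `Real.sq_cosh_half_le`. The
Taylor terms raise the degree, so `k` must stay general. -/
theorem CoshApproximable.cos_pow_mul_pow {c τ : ℝ} (hc : 0 < c) (hτ : |τ| ≤ c / 4) (j k : ℕ) :
    CoshApproximable c fun s => Real.cos (τ * s) ^ j * s ^ (2 * k) := by
  induction j generalizing k with
  | zero =>
    have := of_polynomial (c := c) (Polynomial.X ^ k)
    simpa [← pow_mul] using this
  | succ j ih =>
    refine of_approx fun ε hε => ?_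
    set K : ℝ := (2 * k).factorial / (c / 2) ^ (2 * k) with hK
    have hK0 : 0 < K := by positivity
    obtain ⟨N, hN⟩ := exists_pow_lt_of_lt_one (show (0 : ℝ) < ε / K by positivity)
      (show (1 / 4 : ℝ) < 1 by norm_num)
    refine ⟨fun s => ∑ l ∈ Finset.range N, ((-1) ^ l * τ ^ (2 * l) / ((2 * l).factorial : ℝ)) *
      (Real.cos (τ * s) ^ j * s ^ (2 * (k + l))), sum _ fun l _ => (ih (k + l)).const_mul _,
      fun s => ?_⟩
    have e : Real.cos (τ * s) ^ (j + 1) * s ^ (2 * k) - ∑ l ∈ Finset.range N,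
        ((-1) ^ l * τ ^ (2 * l) / ((2 * l).factorial : ℝ)) *
          (Real.cos (τ * s) ^ j * s ^ (2 * (k + l))) =
        Real.cos (τ * s) ^ j * s ^ (2 * k) * (Real.cos (τ * s) - ∑ l ∈ Finset.range N,
          (-1) ^ l * (τ * s) ^ (2 * l) / ((2 * l).factorial : ℝ)) := by
      rw [mul_sub, Finset.mul_sum]
      congr 1
      · ring
      · refine Finset.sum_congr rfl fun l _ => ?_
        rw [mul_add, pow_add, mul_pow]; ring
    rw [e, abs_mul, abs_mul]
    have h1 : |Real.cos (τ * s) ^ j| ≤ 1 := by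
      rw [abs_pow]; exact pow_le_one₀ (abs_nonneg _) (Real.abs_cos_le_one _)
    have hs0 : 0 ≤ s ^ (2 * k) := by rw [pow_mul]; positivity
    have h2 : |s ^ (2 * k)| ≤ K * Real.cosh (c * s / 2) := by
      rw [abs_of_nonneg hs0]
      have := Real.pow_two_mul_le_cosh (c * s / 2) k
      rw [hK, div_mul_eq_mul_div, le_div_iff₀ (by positivity), ← mul_pow]
      rwa [show s * (c / 2) = c * s / 2 by ring]
    have h3 := Real.abs_cos_sub_sum_le (τ * s) N
    have h4 : Real.cosh (2 * (τ * s)) ≤ Real.cosh (c * s / 2) := by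
      rw [Real.cosh_le_cosh, abs_mul, abs_mul, abs_div, abs_mul, abs_of_pos hc]
      norm_num
      nlinarith [abs_nonneg s]
    have hch := Real.cosh_pos (c * s / 2)
    calc |Real.cos (τ * s) ^ j| * |s ^ (2 * k)| * _
        ≤ 1 * (K * Real.cosh (c * s / 2)) * ((1 / 4) ^ N * Real.cosh (c * s / 2)) := by
          refine mul_le_mul (mul_le_mul h1 h2 (abs_nonneg _) zero_le_one)
            (h3.trans (mul_le_mul_of_nonneg_left h4 (by positivity))) (abs_nonneg _) (by positivity)
      _ = (K * (1 / 4) ^ N) * (Real.cosh (c * s / 2) * Real.cosh (c * s / 2)) := by ring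
      _ ≤ ε * Real.cosh (c * s) := by
          refine mul_le_mul ?_ (Real.sq_cosh_half_le _) (by positivity) hε.le
          rw [lt_div_iff₀ hK0] at hN
          linarith

/-- A continuous even function of subexponential growth, monotone on the half-line, is
approximable. -/
theorem CoshApproximable.of_monotone {c : ℝ} (hc : 0 < c) {f : ℝ → ℝ} (hf : Continuous f)
    (heven : ∀ s, f |s| = f s) (hmono : MonotoneOn f (Set.Ici 0)) (h0 : 0 ≤ f 0)
    (hlim : ∀ ε > 0, ∀ᶠ s in atTop, f s ≤ ε * Real.cosh (c * s)) : CoshApproximable c f := by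
  refine of_approx fun ε hε => ?_
  obtain ⟨R₀, hR₀⟩ := eventually_atTop.1 (hlim (ε / 2) (by positivity))
  -- Beyond `R₀` the weight dominates `f`; the other bound gives `τ = π / R ≤ c / 4`, while `s ↦ cos
  -- (τ * s)` is injective on `[0, R]`.
  set R : ℝ := max R₀ (4 * Real.pi / c) with hR
  have hRpos : 0 < R := lt_max_of_lt_right (by have := Real.pi_pos; positivity)
  set τ : ℝ := Real.pi / R with hτ
  have hτpos : 0 < τ := div_pos Real.pi_pos hRpos
  have hτc : |τ| ≤ c / 4 := by
    rw [abs_of_pos hτpos, hτ, div_le_iff₀ hRpos]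
    have : 4 * Real.pi / c ≤ R := le_max_right _ _
    rw [div_le_iff₀ hc] at this
    linarith
  obtain ⟨q, hq⟩ := exists_polynomial_near_of_continuousOn (-1) 1
    (fun y => f (Real.arccos y / τ))
    (hf.comp (Real.continuous_arccos.div_const τ)).continuousOn (ε / 2) (by positivity)
  refine ⟨fun s => q.eval (Real.cos (τ * s)), ?_, fun s => ?_⟩
  · have e : (fun s => q.eval (Real.cos (τ * s))) = fun s => ∑ j ∈ Finset.range (q.natDegree + 1),
        q.coeff j * (Real.cos (τ * s) ^ j * s ^ (2 * 0)) := by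
      funext s
      rw [Polynomial.eval_eq_sum_range]
      simp
    rw [e]
    exact sum _ fun j _ => (cos_pow_mul_pow hc hτc j 0).const_mul _
  · have hch := Real.one_le_cosh (c * s)
    have h1 := (hq (Real.cos (τ * s)) ⟨Real.neg_one_le_cos _, Real.cos_le_one _⟩).le
    beta_reduce
    -- The point `s` folded into `[0, R]`: it equals `|s|` when `|s| ≤ R`. Otherwise monotonicity
    -- gives `0 ≤ f a ≤ f s`, and the weight absorbs the difference.
    set a := Real.arccos (Real.cos (τ * s)) / τ with ha
    have ha0 : 0 ≤ a := div_nonneg (Real.arccos_nonneg _) hτpos.le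
    have haR : a ≤ R := by
      rw [ha, div_le_iff₀ hτpos, hτ, mul_div_cancel₀ _ hRpos.ne']
      exact Real.arccos_le_pi _
    have h2 : |f s - f a| ≤ ε / 2 * Real.cosh (c * s) := by
      rcases le_total |s| R with hs | hs
      · have : a = |s| := by
          rw [ha, ← Real.cos_abs, abs_mul, abs_of_pos hτpos, Real.arccos_cos (by positivity),
            mul_div_cancel_left₀ _ hτpos.ne']
          rw [hτ, div_mul_eq_mul_div, div_le_iff₀ hRpos]
          exact mul_le_mul_of_nonneg_left hs Real.pi_pos.le
        rw [this, heven, sub_self, abs_zero]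
        positivity
      · have b1 : f a ≤ f s := by
          rw [← heven s]
          exact hmono ha0 (abs_nonneg s) (haR.trans hs)
        have b2 : 0 ≤ f a := h0.trans (hmono Set.self_mem_Ici ha0 ha0)
        have b3 : f s ≤ ε / 2 * Real.cosh (c * s) := by
          have := hR₀ |s| ((le_max_left _ _).trans hs)
          rwa [heven, ← abs_of_pos hc, ← abs_mul, Real.cosh_abs] at this
        rw [abs_of_nonneg (by linarith)]
        linarith
    rw [abs_sub_comm] at h1
    have := abs_sub_le (f s) (f a) (q.eval (Real.cos (τ * s)))
    nlinarith

theorem coshApproximable_log_one_add {c σ : ℝ} (hc : 0 < c) (hσ : 0 < σ) :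
    CoshApproximable c fun s => Real.log (1 + 1 / σ ^ 2 * s ^ 2) := by
  have hpos : ∀ s : ℝ, 0 < 1 + 1 / σ ^ 2 * s ^ 2 := fun s => by positivity
  refine CoshApproximable.of_monotone hc ?_ (by simp) ?_ (by simp) ?_
  · exact Continuous.log (by fun_prop) fun s => (hpos s).ne'
  · intro a ha b hb hab
    have : (0 : ℝ) ≤ a := ha
    exact Real.log_le_log (hpos a) (by gcongr)
  · intro ε hε
    -- Chosen so that `s ^ 2 ≥ K` makes `s ^ 2 / σ ^ 2` at most `ε` times the quartic term `(c * s)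
    -- ^ 4 / 24` of `cosh`.
    set K : ℝ := 24 / (ε * c ^ 4 * σ ^ 2) with hK
    filter_upwards [eventually_ge_atTop (max 1 K)] with s hs
    have hs1 : 1 ≤ s := (le_max_left _ _).trans hs
    have hsK : K ≤ s ^ 2 := ((le_max_right _ _).trans hs).trans (by nlinarith)
    have h1 := Real.log_le_sub_one_of_pos (hpos s)
    have h2 := Real.pow_two_mul_le_cosh (c * s) 2
    norm_num [Nat.factorial] at h2
    have h3 : 1 / σ ^ 2 * s ^ 2 ≤ ε * ((c * s) ^ 4 / 24) := by
      rw [hK, div_le_iff₀ (by positivity)] at hsK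
      rw [div_mul_eq_mul_div, div_le_iff₀ (by positivity)]
      nlinarith [sq_nonneg s]
    have h4 : (c * s) ^ 4 / 24 ≤ Real.cosh (c * s) := by linarith
    have := mul_le_mul_of_nonneg_left h4 hε.le
    linarith

end WeightedApproximation

/-! ### Kernels of index sequences -/

section Kernel

variable {ι α β : Type*}

/-- The map sending each index to a chosen representative of its fibre; it depends only on the
kernel of the given map. -/
noncomputable def kernelRep (f : ι → α) (x : ι) : ι :=
  Quotient.out (Quotient.mk (Setoid.ker f) x)

theorem apply_kernelRep (f : ι → α) (x : ι) : f (kernelRep f x) = f x :=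
  Quotient.mk_out (s := Setoid.ker f) x

theorem kernelRep_eq_iff {f : ι → α} {x y : ι} :
    kernelRep f x = kernelRep f y ↔ f x = f y := by
  constructor
  · intro h
    rw [← apply_kernelRep f x, h, apply_kernelRep f y]
  · intro h
    have : Quotient.mk (Setoid.ker f) x = Quotient.mk (Setoid.ker f) y := Quotient.sound h
    rw [kernelRep, kernelRep, this]

theorem kernelRep_congr {f : ι → α} {g : ι → β} (h : ∀ x y, f x = f y ↔ g x = g y) :
    kernelRep f = kernelRep g := by
  have hk : Setoid.ker f = Setoid.ker g := Setoid.ext fun x y => h x y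
  funext x
  rw [kernelRep, kernelRep, hk]

theorem kernelRep_eq_kernelRep_iff {f : ι → α} {g : ι → β} :
    kernelRep f = kernelRep g ↔ ∀ x y, f x = f y ↔ g x = g y := by
  refine ⟨fun h x y => ?_, kernelRep_congr⟩
  rw [← kernelRep_eq_iff (f := f), h, kernelRep_eq_iff]

theorem kernelRep_kernelRep (f : ι → α) : kernelRep (kernelRep f) = kernelRep f :=
  kernelRep_congr fun _ _ => kernelRep_eq_iff

variable [Fintype ι]

section Count

variable [DecidableEq ι]

/-- The number of maps into `m` letters with the same kernel as a self-map `c` that represents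
its own kernel. -/
noncomputable def kernelCount (c : ι → ι) (m : ℕ) : ℕ :=
  (Finset.univ.filter fun f : ι → Fin m => kernelRep f = c).card

/-- The representatives are the fixed points of `c`; a map with this kernel is determined by its
values on them, which are distinct and otherwise arbitrary. -/
theorem kernelCount_eq_descFactorial {c : ι → ι} (hc : kernelRep c = c) (m : ℕ) :
    kernelCount c m = m.descFactorial (Finset.univ.image c).card := by
  classical
  have e : {f : ι → Fin m // kernelRep f = c} ≃ ({x // x ∈ Finset.univ.image c} ↪ Fin m) :=
    { toFun := fun f => ⟨fun x => f.1 x, by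
        rintro ⟨x, hx⟩ ⟨y, hy⟩ hxy
        simp only [Finset.mem_image, Finset.mem_univ, true_and] at hx hy
        obtain ⟨x, rfl⟩ := hx
        obtain ⟨y, rfl⟩ := hy
        have h := kernelRep_eq_kernelRep_iff.1 (f.2.trans hc.symm)
        have hcc : ∀ z, c (c z) = c z := fun z => by
          have := apply_kernelRep c z
          rwa [hc] at this
        have h2 := (h _ _).1 hxy
        rw [hcc, hcc] at h2
        exact Subtype.ext h2⟩
      invFun := fun g => ⟨fun x => g ⟨c x, by simp⟩, by
        refine (kernelRep_congr fun x y => ?_).trans hc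
        rw [g.injective.eq_iff, Subtype.mk.injEq]⟩
      left_inv := by
        rintro ⟨f, rfl⟩
        ext x : 2
        exact apply_kernelRep f x
      right_inv := by
        intro g
        ext ⟨x, hx⟩ : 1
        simp only [Finset.mem_image, Finset.mem_univ, true_and] at hx
        obtain ⟨x, rfl⟩ := hx
        change g ⟨c (c x), _⟩ = g ⟨c x, _⟩
        congr 2
        have h := apply_kernelRep c x
        rwa [hc] at h }
  rw [kernelCount, ← Fintype.card_subtype, Fintype.card_congr e, Fintype.card_embedding_eq,
    Fintype.card_fin, Fintype.card_coe]

/-- Allows sums over all self-maps `c`: those that are not canonical representatives drop out. -/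
theorem kernelCount_eq_zero {c : ι → ι} (hc : kernelRep c ≠ c) (m : ℕ) : kernelCount c m = 0 := by
  rw [kernelCount, Finset.card_eq_zero, Finset.filter_eq_empty_iff]
  rintro f - rfl
  exact hc (kernelRep_kernelRep f)

theorem kernelCount_le (c : ι → ι) (m : ℕ) :
    kernelCount c m ≤ m ^ (Finset.univ.image c).card := by
  by_cases hc : kernelRep c = c
  · rw [kernelCount_eq_descFactorial hc]
    exact Nat.descFactorial_le_pow _ _
  · rw [kernelCount_eq_zero hc]
    exact Nat.zero_le _

/-- After regrouping by kernel the number of terms no longer depends on `m`, so limits can be taken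
term by term. -/
theorem sum_eq_sum_kernelCount (m : ℕ) (F : (ι → Fin m) → ℝ) (G : (ι → ι) → ℝ)
    (h : ∀ f, F f = G (kernelRep f)) :
    ∑ f, F f = ∑ c, (kernelCount c m : ℝ) * G c := by
  rw [← Finset.sum_fiberwise_of_maps_to (s := Finset.univ) (t := Finset.univ)
    (g := fun f : ι → Fin m => kernelRep f) (fun _ _ => Finset.mem_univ _)]
  refine Finset.sum_congr rfl fun c _ => ?_
  rw [kernelCount, Finset.card_eq_sum_ones, Nat.cast_sum, Finset.sum_mul]
  refine Finset.sum_congr rfl fun f hf => ?_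
  rw [h f, (Finset.mem_filter.1 hf).2]
  simp

end Count

/-! ### Products of moments over the fibres of a map -/

variable [DecidableEq α] [DecidableEq β]

/-- The product of `μ` of the fibre cardinalities, over the values of a map. -/
def fiberProd (μ : ℕ → ℝ) (f : ι → α) : ℝ :=
  ∏ q ∈ Finset.univ.image f, μ (Finset.univ.filter fun x => f x = q).card

theorem exists_image_eq_image [Nonempty ι] {f : ι → α} {g : ι → β}
    (h : ∀ x y, f x = f y ↔ g x = g y) : ∃ φ : α → β, (∀ x, φ (f x) = g x) ∧
      Set.InjOn φ (Finset.univ.image f) ∧ (Finset.univ.image f).image φ = Finset.univ.image g := by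
  have h1 : ∀ x, g (Function.invFun f (f x)) = g x := fun x =>
    (h _ _).1 (Function.invFun_eq ⟨x, rfl⟩)
  refine ⟨fun q => g (Function.invFun f q), h1, ?_, ?_⟩
  · intro a ha b hb hab
    simp only [Finset.coe_image, Finset.coe_univ, Set.image_univ, Set.mem_range] at ha hb
    obtain ⟨x, rfl⟩ := ha
    obtain ⟨y, rfl⟩ := hb
    simp only [h1] at hab
    exact (h x y).2 hab
  · rw [Finset.image_image]
    congr 1
    funext x
    exact h1 x

theorem card_image_congr [Nonempty ι] {f : ι → α} {g : ι → β} (h : ∀ x y, f x = f y ↔ g x = g y) :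
    (Finset.univ.image f).card = (Finset.univ.image g).card := by
  obtain ⟨φ, -, h2, h3⟩ := exists_image_eq_image h
  rw [← h3, Finset.card_image_of_injOn h2]

theorem fiberProd_congr [Nonempty ι] (μ : ℕ → ℝ) {f : ι → α} {g : ι → β}
    (h : ∀ x y, f x = f y ↔ g x = g y) : fiberProd μ f = fiberProd μ g := by
  obtain ⟨φ, h1, h2, h3⟩ := exists_image_eq_image h
  rw [fiberProd, fiberProd, ← h3, Finset.prod_image h2]
  refine Finset.prod_congr rfl fun q hq => ?_
  obtain ⟨x, -, rfl⟩ := Finset.mem_image.1 hq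
  simp only [h1, h]

theorem sum_card_fiber (f : ι → α) :
    ∑ q ∈ Finset.univ.image f, (Finset.univ.filter fun x => f x = q).card = Fintype.card ι :=
  (Finset.card_eq_sum_card_image f Finset.univ).symm

theorem card_fiber_pos {f : ι → α} {q : α} (hq : q ∈ Finset.univ.image f) :
    0 < (Finset.univ.filter fun x => f x = q).card := by
  obtain ⟨x, -, rfl⟩ := Finset.mem_image.1 hq
  exact Finset.card_pos.2 ⟨x, by simp⟩

/-- A singleton fibre contributes the factor `μ 1 = 0`, so in a nonzero product every fibre has at
least two points. -/
theorem two_mul_card_image_le {μ : ℕ → ℝ} (h1 : μ 1 = 0) {f : ι → α} (hf : fiberProd μ f ≠ 0) :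
    2 * (Finset.univ.image f).card ≤ Fintype.card ι := by
  rw [← sum_card_fiber f, mul_comm, ← smul_eq_mul, ← Finset.sum_const]
  refine Finset.sum_le_sum fun q hq => ?_
  have hp := card_fiber_pos hq
  have hne : (Finset.univ.filter fun x => f x = q).card ≠ 1 := fun h =>
    hf (Finset.prod_eq_zero hq (by rw [h, h1]))
  omega

open Classical in
/-- The common value of `fiberProd μ f` over all `μ` with `μ 1 = 0` and `μ 2 = 1`, when the
image of `f` has half as many elements as its domain. -/
noncomputable def pairIndicator (f : ι → α) : ℝ :=
  if ∀ q ∈ Finset.univ.image f, (Finset.univ.filter fun x => f x = q).card = 2 then 1 else 0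

/-- Unless the product vanishes, all fibres have at least two points, and equality in the count then
forces exactly two. Higher moments therefore never enter. -/
theorem fiberProd_eq_pairIndicator {μ : ℕ → ℝ} (h1 : μ 1 = 0) (h2 : μ 2 = 1) {f : ι → α}
    (hf : 2 * (Finset.univ.image f).card = Fintype.card ι) : fiberProd μ f = pairIndicator f := by
  rw [pairIndicator]
  split_ifs with h
  · rw [fiberProd, Finset.prod_eq_one]
    intro q hq
    rw [h q hq, h2]
  · by_contra hne
    apply h
    have hle : ∀ q ∈ Finset.univ.image f, 2 ≤ (Finset.univ.filter fun x => f x = q).card := by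
      intro q hq
      have hp := card_fiber_pos hq
      have : (Finset.univ.filter fun x => f x = q).card ≠ 1 := fun h =>
        hne (Finset.prod_eq_zero hq (by rw [h, h1]))
      omega
    have hs : ∑ q ∈ Finset.univ.image f, 2 =
        ∑ q ∈ Finset.univ.image f, (Finset.univ.filter fun x => f x = q).card := by
      rw [sum_card_fiber, Finset.sum_const, smul_eq_mul, mul_comm, hf]
    intro q hq
    exact ((Finset.sum_eq_sum_iff_of_le hle).1 hs q hq).symm

theorem pairIndicator_eq_zero {f : ι → α} (hf : 2 * (Finset.univ.image f).card ≠ Fintype.card ι) :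
    pairIndicator f = 0 := by
  rw [pairIndicator, if_neg]
  intro h
  apply hf
  rw [← sum_card_fiber f, Finset.sum_congr rfl h, Finset.sum_const, smul_eq_mul, mul_comm]

theorem abs_fiberProd_le {μ : ℕ → ℝ} {K : ℝ} (hμ : ∀ k, |μ k| ≤ K ^ k) (f : ι → α) :
    |fiberProd μ f| ≤ K ^ Fintype.card ι := by
  rw [fiberProd, Finset.abs_prod, ← sum_card_fiber f, ← Finset.prod_pow_eq_pow_sum]
  exact Finset.prod_le_prod (fun _ _ => abs_nonneg _) fun q _ => hμ _

theorem fiberProd_scale {μ : ℕ → ℝ} (a b : ℝ) (f : ι → α) :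
    fiberProd (fun k => a * b ^ k * μ k) f =
      a ^ (Finset.univ.image f).card * b ^ Fintype.card ι * fiberProd μ f := by
  rw [fiberProd, Finset.prod_mul_distrib, Finset.prod_mul_distrib, Finset.prod_const,
    Finset.prod_pow_eq_pow_sum, sum_card_fiber, fiberProd]

end Kernel

/-! ### Closed walks on a complete bipartite graph -/

section Walks

variable {α β : Type*}

/-- The edges traversed by the closed walk `j 0, i 0, j 1, i 1, …, j 0`. -/
def walkEdge {k : ℕ} (i : Fin (k + 1) → α) (j : Fin (k + 1) → β) (x : Fin (k + 1) × Bool) : α × β :=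
  (i x.1, if x.2 then j (x.1 + 1) else j x.1)

theorem walkEdge_kernel {k : ℕ} {α' β' : Type*} {i : Fin (k + 1) → α} {j : Fin (k + 1) → β}
    {i' : Fin (k + 1) → α'} {j' : Fin (k + 1) → β'} (hi : ∀ x y, i x = i y ↔ i' x = i' y)
    (hj : ∀ x y, j x = j y ↔ j' x = j' y) (x y : Fin (k + 1) × Bool) :
    walkEdge i j x = walkEdge i j y ↔ walkEdge i' j' x = walkEdge i' j' y := by
  obtain ⟨x, u⟩ := x
  obtain ⟨y, v⟩ := y
  cases u <;> cases v <;> simp [walkEdge, hi, hj]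

variable [DecidableEq α] [DecidableEq β]

/-- A connected graph has at most one vertex more than it has edges: along the walk, each new vertex
is reached through a new edge. -/
theorem card_vertices_le_card_edges (i : ℕ → α) (j : ℕ → β) (r : ℕ) :
    ((Finset.range r).image i).card + ((Finset.range (r + 1)).image j).card ≤
      ((Finset.range r).image (fun l => (i l, j l)) ∪
        (Finset.range r).image (fun l => (i l, j (l + 1)))).card + 1 := by
  induction r with
  | zero => simp
  | succ r ih =>
    set I := (Finset.range r).image i with hI
    set J := (Finset.range (r + 1)).image j with hJ
    set E := (Finset.range r).image (fun l => (i l, j l)) ∪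
        (Finset.range r).image (fun l => (i l, j (l + 1))) with hE
    have e1 : (Finset.range (r + 1)).image i = insert (i r) I := by
      rw [Finset.range_add_one, Finset.image_insert]
    have e2 : (Finset.range (r + 1 + 1)).image j = insert (j (r + 1)) J := by
      rw [Finset.range_add_one, Finset.image_insert]
    have e3 : (Finset.range (r + 1)).image (fun l => (i l, j l)) ∪
        (Finset.range (r + 1)).image (fun l => (i l, j (l + 1))) =
        insert (i r, j (r + 1)) (insert (i r, j r) E) := by
      rw [Finset.range_add_one, Finset.image_insert, Finset.image_insert]
      ext x
      simp only [hE, Finset.mem_union, Finset.mem_insert]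
      tauto
    have hEI : ∀ q ∈ E, q.1 ∈ I ∧ q.2 ∈ J := by
      intro q hq
      simp only [hE, Finset.mem_union, Finset.mem_image, Finset.mem_range] at hq
      rcases hq with ⟨l, hl, rfl⟩ | ⟨l, hl, rfl⟩
      · exact ⟨Finset.mem_image_of_mem _ (Finset.mem_range.2 hl),
          Finset.mem_image_of_mem _ (Finset.mem_range.2 (by omega))⟩
      · exact ⟨Finset.mem_image_of_mem _ (Finset.mem_range.2 hl),
          Finset.mem_image_of_mem _ (Finset.mem_range.2 (by omega))⟩
    have hjr : j r ∈ J := Finset.mem_image_of_mem _ (Finset.mem_range.2 (by omega))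
    have s1 : (insert (i r) I).card + E.card ≤ I.card + (insert (i r, j r) E).card := by
      by_cases h : i r ∈ I
      · rw [Finset.insert_eq_of_mem h]
        have := Finset.card_le_card (Finset.subset_insert (i r, j r) E)
        omega
      · rw [Finset.card_insert_of_notMem h,
          Finset.card_insert_of_notMem fun h' => h (hEI _ h').1]
        omega
    have s2 : (insert (j (r + 1)) J).card + (insert (i r, j r) E).card ≤
        J.card + (insert (i r, j (r + 1)) (insert (i r, j r) E)).card := by
      by_cases h : j (r + 1) ∈ J
      · rw [Finset.insert_eq_of_mem h]
        have := Finset.card_le_card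
          (Finset.subset_insert (i r, j (r + 1)) (insert (i r, j r) E))
        omega
      · have hn : (i r, j (r + 1)) ∉ insert (i r, j r) E := by
          rw [Finset.mem_insert]
          rintro (h' | h')
          · rw [Prod.mk.injEq] at h'
            exact h (h'.2 ▸ hjr)
          · exact h (hEI _ h').2
        rw [Finset.card_insert_of_notMem h, Finset.card_insert_of_notMem hn]
        omega
    rw [e1, e2, e3]
    omega

theorem card_image_add_card_image_le {k : ℕ} (i : Fin (k + 1) → α) (j : Fin (k + 1) → β) :
    (Finset.univ.image i).card + (Finset.univ.image j).card ≤
      (Finset.univ.image (walkEdge i j)).card + 1 := by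
  -- The walk is unrolled periodically; `j' (k + 1) = j' 0` closes it.
  set i' : ℕ → α := fun l => i (Fin.ofNat (k + 1) l) with hi'
  set j' : ℕ → β := fun l => j (Fin.ofNat (k + 1) l) with hj'
  have hval : ∀ x : Fin (k + 1), Fin.ofNat (k + 1) (x : ℕ) = x := fun x => by
    ext; simp
  have h := card_vertices_le_card_edges i' j' (k + 1)
  have a1 : (Finset.univ.image i).card ≤ ((Finset.range (k + 1)).image i').card := by
    refine Finset.card_le_card fun q hq => ?_
    obtain ⟨x, -, rfl⟩ := Finset.mem_image.1 hq
    exact Finset.mem_image.2 ⟨x, Finset.mem_range.2 x.2, by simp only [hi', hval]⟩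
  have a2 : (Finset.univ.image j).card ≤ ((Finset.range (k + 1 + 1)).image j').card := by
    refine Finset.card_le_card fun q hq => ?_
    obtain ⟨x, -, rfl⟩ := Finset.mem_image.1 hq
    exact Finset.mem_image.2 ⟨x, Finset.mem_range.2 (by omega), by simp only [hj', hval]⟩
  have a3 : ((Finset.range (k + 1)).image (fun l => (i' l, j' l)) ∪
      (Finset.range (k + 1)).image (fun l => (i' l, j' (l + 1)))).card ≤
        (Finset.univ.image (walkEdge i j)).card := by
    refine Finset.card_le_card fun q hq => ?_
    simp only [Finset.mem_union, Finset.mem_image, Finset.mem_range, Finset.mem_univ,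
      true_and] at hq ⊢
    rcases hq with ⟨l, hl, rfl⟩ | ⟨l, hl, rfl⟩
    · exact ⟨(Fin.ofNat (k + 1) l, false), by simp [walkEdge, hi', hj']⟩
    · refine ⟨(Fin.ofNat (k + 1) l, true), ?_⟩
      simp only [walkEdge, hi', hj', if_true, Prod.mk.injEq, true_and]
      congr 1
      ext
      simp [Fin.val_add]
  omega

open Matrix in
-- Expansion over paths starting at `a`. The free vector `v` lets the induction peel off the first
-- step; taking `v` to be a column of `M` closes the path and yields the trace.
theorem Matrix.pow_mulVec_eq_sum {n : Type*} [Fintype n] [DecidableEq n] (M : Matrix n n ℝ)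
    (k : ℕ) (v : n → ℝ) (a : n) : (M ^ k *ᵥ v) a = ∑ f : Fin k → n,
      (∏ l : Fin k, M ((Fin.cons a f : Fin (k + 1) → n) l.castSucc) (f l)) *
        v ((Fin.cons a f : Fin (k + 1) → n) (Fin.last k)) := by
  induction k generalizing a with
  | zero => simp
  | succ k ih =>
    rw [pow_succ', ← mulVec_mulVec, mulVec, dotProduct]
    rw [← (Fin.consEquiv fun _ => n).sum_comp, Fintype.sum_prod_type]
    refine Finset.sum_congr rfl fun b _ => ?_
    rw [ih, Finset.mul_sum]
    refine Finset.sum_congr rfl fun f _ => ?_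
    simp only [Fin.consEquiv_apply]
    rw [Fin.prod_univ_succ, ← Fin.succ_last, Fin.cons_succ, Fin.castSucc_zero, Fin.cons_zero,
      Fin.cons_zero, mul_assoc]
    congr 1

open Matrix in
theorem Matrix.trace_pow_succ_eq_sum {n : Type*} [Fintype n] [DecidableEq n] (M : Matrix n n ℝ)
    (k : ℕ) : (M ^ (k + 1)).trace = ∑ j : Fin (k + 1) → n, ∏ l, M (j l) (j (l + 1)) := by
  rw [← (Fin.consEquiv fun _ => n).sum_comp, Fintype.sum_prod_type, trace]
  refine Finset.sum_congr rfl fun a _ => ?_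
  have h := pow_mulVec_eq_sum M k (fun b => M b a) a
  rw [diag_apply, pow_succ]
  refine h.trans (Finset.sum_congr rfl fun f _ => ?_)
  simp only [Fin.consEquiv_apply]
  rw [Fin.prod_univ_castSucc]
  simp

open Matrix in
theorem Matrix.trace_transpose_mul_self_pow {m n : ℕ} (X : Matrix (Fin m) (Fin n) ℝ) (k : ℕ) :
    ((Xᵀ * X) ^ (k + 1)).trace = ∑ i : Fin (k + 1) → Fin m, ∑ j : Fin (k + 1) → Fin n,
      ∏ x, X (walkEdge i j x).1 (walkEdge i j x).2 := by
  rw [trace_pow_succ_eq_sum, Finset.sum_comm]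
  refine Finset.sum_congr rfl fun j _ => ?_
  simp only [mul_apply, transpose_apply]
  rw [Finset.prod_univ_sum, Fintype.piFinset_univ]
  refine Finset.sum_congr rfl fun i _ => ?_
  rw [Fintype.prod_prod_type]
  refine Finset.prod_congr rfl fun l _ => ?_
  simp [walkEdge, mul_comm]

end Walks

/-! ### Trace moments of random matrices with independent scaled entries -/

section Moments

/-- The mixed moments of the entries of `X` are those of independent entries whose `e`-th moment
is `(γ / n) * γ ^ (-e / 2) * μ e` for `e ≥ 1`. -/
structure HasScaledMoments {Ω : Type*} [MeasurableSpace Ω] (P : Measure Ω) {m n : ℕ}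
    (X : Ω → Matrix (Fin m) (Fin n) ℝ) (γ : ℝ) (μ : ℕ → ℝ) : Prop where
  measurable : ∀ i j, Measurable fun ω => X ω i j
  bounded : ∃ K, ∀ ω i j, |X ω i j| ≤ K
  moment : ∀ e : Fin m × Fin n → ℕ, ∫ ω, ∏ q, X ω q.1 q.2 ^ e q ∂P =
    ∏ q ∈ Finset.univ.filter (fun q => e q ≠ 0), (γ / n * (Real.sqrt γ)⁻¹ ^ e q * μ (e q))

/-- The normalized trace moments of `Hᵀ H`. -/
noncomputable def traceMoment {m n : ℕ} (k : ℕ) (H : Matrix (Fin m) (Fin n) ℝ) : ℝ :=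
  1 / (n : ℝ) * ((H.transpose * H) ^ k).trace

/-- The number of distinct edges of a closed walk. -/
def edgeCount {k : ℕ} {α β : Type*} [DecidableEq α] [DecidableEq β] (i : Fin (k + 1) → α)
    (j : Fin (k + 1) → β) : ℕ :=
  (Finset.univ.image (walkEdge i j)).card

/-- The normalized number of closed walks in the `m × n` complete bipartite graph with the kernel
prescribed by `c` and `d`. -/
noncomputable def walkDensity {k : ℕ} (c d : Fin (k + 1) → Fin (k + 1)) (m n : ℕ) : ℝ :=
  kernelCount c m * kernelCount d n / (n : ℝ) ^ (edgeCount c d + 1)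

/-- The expected trace moment of order `k + 1`, as a sum over the kernels of closed walks. -/
noncomputable def modelMoment (μ : ℕ → ℝ) (γ : ℝ) (m n k : ℕ) : ℝ :=
  ∑ c : Fin (k + 1) → Fin (k + 1), ∑ d : Fin (k + 1) → Fin (k + 1),
    fiberProd μ (walkEdge c d) * (γ ^ edgeCount c d / γ ^ (k + 1)) * walkDensity c d m n

namespace HasScaledMoments

variable {Ω : Type*} [MeasurableSpace Ω] {P : Measure Ω} {m n : ℕ}
  {X : Ω → Matrix (Fin m) (Fin n) ℝ} {γ : ℝ} {μ : ℕ → ℝ}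

theorem integral_prod_comp (h : HasScaledMoments P X γ μ) {ι : Type*} [Fintype ι]
    (f : ι → Fin m × Fin n) :
    ∫ ω, ∏ x, X ω (f x).1 (f x).2 ∂P = fiberProd (fun e => γ / n * (Real.sqrt γ)⁻¹ ^ e * μ e) f := by
  have h1 := h.moment fun q => (Finset.univ.filter fun x => f x = q).card
  have e1 : ∀ ω, ∏ x, X ω (f x).1 (f x).2 =
      ∏ q, X ω q.1 q.2 ^ (Finset.univ.filter fun x => f x = q).card := by
    intro ω
    rw [← Finset.prod_fiberwise_of_maps_to (s := Finset.univ) (t := Finset.univ) (g := f)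
      (fun _ _ => Finset.mem_univ _)]
    refine Finset.prod_congr rfl fun q _ => ?_
    rw [← Finset.prod_const]
    refine Finset.prod_congr rfl fun x hx => ?_
    rw [(Finset.mem_filter.1 hx).2]
  simp only [e1, h1, fiberProd]
  refine Finset.prod_congr ?_ fun _ _ => rfl
  ext q
  simp [Finset.card_eq_zero, Finset.filter_eq_empty_iff]

theorem integrable_prod_comp [IsFiniteMeasure P] (h : HasScaledMoments P X γ μ) {ι : Type*}
    [Fintype ι] (f : ι → Fin m × Fin n) :
    Integrable (fun ω => ∏ x, X ω (f x).1 (f x).2) P := by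
  obtain ⟨K, hK⟩ := h.bounded
  refine Integrable.of_bound (C := K ^ Fintype.card ι)
    (Finset.measurable_prod _ fun x _ => h.measurable _ _).aestronglyMeasurable
    (ae_of_all _ fun ω => ?_)
  rw [Real.norm_eq_abs, Finset.abs_prod, ← Finset.card_univ, ← Finset.prod_const]
  exact Finset.prod_le_prod (fun _ _ => abs_nonneg _) fun x _ => hK _ _ _

theorem integrable_traceMoment [IsFiniteMeasure P] (h : HasScaledMoments P X γ μ) (k : ℕ) :
    Integrable (fun ω => traceMoment k (X ω)) P := by
  cases k with
  | zero =>
    simp only [traceMoment, pow_zero]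
    exact integrable_const _
  | succ k =>
    simp only [traceMoment, Matrix.trace_transpose_mul_self_pow]
    exact (integrable_finsetSum _ fun i _ => integrable_finsetSum _ fun j _ =>
      h.integrable_prod_comp (walkEdge i j)).const_mul _

/-- The expectation along a walk depends only on its kernel. Its distinct edges give `(γ / n) ^
edgeCount`, its `2 * (k + 1)` steps give `γ ^ (-(k + 1))`, and the prefactor `1 / n` supplies the
last power of `n` in `walkDensity`. -/
theorem integral_traceMoment [IsFiniteMeasure P] (h : HasScaledMoments P X γ μ) (hγ : 0 < γ)
    (k : ℕ) : ∫ ω, traceMoment (k + 1) (X ω) ∂P = modelMoment μ γ m n k := by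
  have hs : (Real.sqrt γ)⁻¹ ^ ((k + 1) * 2) = (γ ^ (k + 1))⁻¹ := by
    rw [mul_comm, pow_mul, inv_pow, Real.sq_sqrt hγ.le, inv_pow]
  have hw : ∀ (i : Fin (k + 1) → Fin m) (j : Fin (k + 1) → Fin n),
      ∫ ω, ∏ x, X ω (walkEdge i j x).1 (walkEdge i j x).2 ∂P =
        (fun c d : Fin (k + 1) → Fin (k + 1) => (γ / n) ^ edgeCount c d * (γ ^ (k + 1))⁻¹ *
          fiberProd μ (walkEdge c d)) (kernelRep i) (kernelRep j) := by
    intro i j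
    have hker := walkEdge_kernel (i := i) (j := j) (i' := kernelRep i) (j' := kernelRep j)
      (fun _ _ => kernelRep_eq_iff.symm) (fun _ _ => kernelRep_eq_iff.symm)
    rw [h.integral_prod_comp, fiberProd_scale, card_image_congr hker, fiberProd_congr μ hker]
    simp only [Fintype.card_prod, Fintype.card_fin, Fintype.card_bool, hs, edgeCount]
  simp only [traceMoment, Matrix.trace_transpose_mul_self_pow]
  rw [integral_const_mul, integral_finsetSum _ fun i _ => integrable_finsetSum _ fun j _ =>
    h.integrable_prod_comp (walkEdge i j)]
  simp_rw [integral_finsetSum _ fun j _ => h.integrable_prod_comp (walkEdge _ j), hw]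
  rw [modelMoment, sum_eq_sum_kernelCount m _ (fun c => ∑ j : Fin (k + 1) → Fin n,
    (fun c d : Fin (k + 1) → Fin (k + 1) => (γ / n) ^ edgeCount c d * (γ ^ (k + 1))⁻¹ *
          fiberProd μ (walkEdge c d)) c (kernelRep j)) (fun _ => rfl), Finset.mul_sum]
  refine Finset.sum_congr rfl fun c _ => ?_
  rw [sum_eq_sum_kernelCount n _ (fun d => (γ / n) ^ edgeCount c d * (γ ^ (k + 1))⁻¹ *
          fiberProd μ (walkEdge c d)) (fun _ => rfl), Finset.mul_sum, Finset.mul_sum]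
  refine Finset.sum_congr rfl fun d _ => ?_
  rw [walkDensity, div_pow, pow_succ (n : ℝ)]
  simp only [div_eq_mul_inv, mul_inv]
  ring

end HasScaledMoments

/-! ### Limits of the moments -/

theorem exists_tendsto_kernelCount_div {ι : Type*} [Fintype ι] [DecidableEq ι] (c : ι → ι) :
    ∃ a : ℝ, Tendsto (fun m : ℕ => (kernelCount c m : ℝ) / (m : ℝ) ^ (Finset.univ.image c).card)
      atTop (𝓝 a) := by
  by_cases hc : kernelRep c = c
  · refine ⟨1, ?_⟩
    simp only [kernelCount_eq_descFactorial hc]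
    refine (Asymptotics.isEquivalent_iff_tendsto_one ?_).1 (isEquivalent_descFactorial _)
    filter_upwards [eventually_gt_atTop 0] with m hm
    have : (0 : ℝ) < m := by exact_mod_cast hm
    positivity
  · exact ⟨0, by simp [kernelCount_eq_zero hc]⟩

theorem edgeCount_le_of_fiberProd_ne_zero {μ : ℕ → ℝ} (h1 : μ 1 = 0) {k : ℕ}
    {c d : Fin (k + 1) → Fin (k + 1)} (h : fiberProd μ (walkEdge c d) ≠ 0) :
    edgeCount c d ≤ k + 1 := by
  have := two_mul_card_image_le h1 h
  simp only [Fintype.card_prod, Fintype.card_fin, Fintype.card_bool] at this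
  rw [edgeCount]
  omega

/-- With fewer than `k + 1` edges the power of `x` decays; with exactly `k + 1` it is one and the
product is the universal indicator; with more, some edge is used only once and the product is zero.
-/
theorem tendsto_fiberProd_mul_pow {μ : ℕ → ℝ} (h1 : μ 1 = 0) (h2 : μ 2 = 1) {k : ℕ}
    (c d : Fin (k + 1) → Fin (k + 1)) :
    Tendsto (fun x : ℝ => fiberProd μ (walkEdge c d) * (x ^ edgeCount c d / x ^ (k + 1))) atTop
      (𝓝 (pairIndicator (walkEdge c d))) := by
  have hcard : Fintype.card (Fin (k + 1) × Bool) = 2 * (k + 1) := by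
    simp [mul_comm]
  rcases lt_trichotomy (edgeCount c d) (k + 1) with h | h | h
  · rw [pairIndicator_eq_zero (by rw [hcard]; rw [edgeCount] at h; omega)]
    simpa using (tendsto_pow_div_pow_atTop_zero (𝕜 := ℝ) h).const_mul _
  · rw [← fiberProd_eq_pairIndicator h1 h2 (by rw [hcard]; rw [edgeCount] at h; omega), h]
    refine tendsto_const_nhds.congr' ?_
    filter_upwards [eventually_gt_atTop 0] with x hx
    rw [div_self (by positivity), mul_one]
  · rw [pairIndicator_eq_zero (by rw [hcard]; rw [edgeCount] at h; omega)]
    have : fiberProd μ (walkEdge c d) = 0 := by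
      by_contra hne
      exact absurd (edgeCount_le_of_fiberProd_ne_zero h1 hne) (by omega)
    simp [this]

variable {m : ℕ → ℕ} {α : ℝ}

theorem tendsto_atTop_of_ratio (hα : 0 < α)
    (hm : Tendsto (fun n : ℕ => (m n : ℝ) / (n : ℝ)) atTop (𝓝 α)) : Tendsto m atTop atTop := by
  rw [← tendsto_natCast_atTop_iff (R := ℝ)]
  refine (hm.pos_mul_atTop hα tendsto_natCast_atTop_atTop).congr' ?_
  filter_upwards [eventually_gt_atTop 0] with n hn
  have : (n : ℝ) ≠ 0 := by exact_mod_cast hn.ne'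
  field_simp

/-- The count has order `n ^ (u + v)` at most, and `u + v ≤ edgeCount + 1`; the deficit `w` leaves a
factor `n ^ (-w)`, which converges. -/
theorem exists_tendsto_walkDensity (hα : 0 < α)
    (hm : Tendsto (fun n : ℕ => (m n : ℝ) / (n : ℝ)) atTop (𝓝 α)) {k : ℕ}
    (c d : Fin (k + 1) → Fin (k + 1)) :
    ∃ ρ : ℝ, Tendsto (fun n => walkDensity c d (m n) n) atTop (𝓝 ρ) := by
  obtain ⟨a, ha⟩ := exists_tendsto_kernelCount_div c
  obtain ⟨b, hb⟩ := exists_tendsto_kernelCount_div d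
  have ha' := ha.comp (tendsto_atTop_of_ratio hα hm)
  set u := (Finset.univ.image c).card with hu
  set v := (Finset.univ.image d).card with hv
  have huv : u + v ≤ edgeCount c d + 1 := card_image_add_card_image_le c d
  obtain ⟨w, hw⟩ : ∃ w, edgeCount c d + 1 = u + v + w := ⟨_, (Nat.add_sub_of_le huv).symm⟩
  obtain ⟨z, hz⟩ : ∃ z : ℝ, Tendsto (fun n : ℕ => ((n : ℝ) ^ w)⁻¹) atTop (𝓝 z) := by
    rcases Nat.eq_zero_or_pos w with rfl | hw0
    · exact ⟨1, by simp⟩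
    · exact ⟨0, ((tendsto_pow_atTop hw0.ne').comp
        (tendsto_natCast_atTop_atTop (R := ℝ))).inv_tendsto_atTop⟩
  refine ⟨a * α ^ u * b * z, (((ha'.mul (hm.pow u)).mul hb).mul hz).congr' ?_⟩
  filter_upwards [eventually_gt_atTop 0,
    (tendsto_atTop_of_ratio hα hm).eventually_gt_atTop 0] with n hn hmn
  have h1 : (n : ℝ) ≠ 0 := by exact_mod_cast hn.ne'
  have h2 : (m n : ℝ) ≠ 0 := by exact_mod_cast hmn.ne'
  simp only [Function.comp_apply]
  rw [walkDensity, hw, pow_add, pow_add, div_pow]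
  field_simp

/-- Universality: `U` is fixed before `μ`. Taking `γ = n`, or `n → ∞` and then `γ → ∞`, sends the
weights of the kernels to the same `pairIndicator`, and the densities do not involve `γ`. -/
theorem modelMoment_limits (hα : 0 < α)
    (hm : Tendsto (fun n : ℕ => (m n : ℝ) / (n : ℝ)) atTop (𝓝 α)) (k : ℕ) :
    ∃ U : ℝ,
      (∀ μ : ℕ → ℝ, μ 1 = 0 → μ 2 = 1 →
        Tendsto (fun n : ℕ => modelMoment μ n (m n) n k) atTop (𝓝 U)) ∧
      (∀ μ : ℕ → ℝ, μ 1 = 0 → μ 2 = 1 → ∃ V : ℝ → ℝ,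
        (∀ γ, Tendsto (fun n : ℕ => modelMoment μ γ (m n) n k) atTop (𝓝 (V γ))) ∧
        Tendsto V atTop (𝓝 U)) := by
  choose ρ hρ using fun c d => exists_tendsto_walkDensity (k := k) hα hm c d
  refine ⟨∑ c, ∑ d, pairIndicator (walkEdge c d) * ρ c d, fun μ h1 h2 => ?_, fun μ h1 h2 =>
    ⟨fun γ => ∑ c, ∑ d,
      fiberProd μ (walkEdge c d) * (γ ^ edgeCount c d / γ ^ (k + 1)) * ρ c d, fun γ => ?_, ?_⟩⟩
  · exact tendsto_finsetSum _ fun c _ => tendsto_finsetSum _ fun d _ =>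
      ((tendsto_fiberProd_mul_pow h1 h2 c d).comp tendsto_natCast_atTop_atTop).mul (hρ c d)
  · exact tendsto_finsetSum _ fun c _ => tendsto_finsetSum _ fun d _ => (hρ c d).const_mul _
  · exact tendsto_finsetSum _ fun c _ => tendsto_finsetSum _ fun d _ =>
      (tendsto_fiberProd_mul_pow h1 h2 c d).mul_const _

/-! ### Growth of the moments -/

/-- Controls the number of pairs of self-maps indexing `modelMoment`, through `K ^ K ≤ e ^ K * K!`
and `K! ^ 2 ≤ (2 * K)!`. -/
theorem pow_self_mul_pow_self_le (K : ℕ) :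
    ((K : ℝ) ^ K) * (K : ℝ) ^ K ≤ Real.exp 1 ^ (2 * K) * (2 * K).factorial := by
  have h := Real.pow_div_factorial_le_exp (K : ℝ) (Nat.cast_nonneg K) K
  rw [div_le_iff₀ (by positivity), ← Real.exp_one_pow] at h
  have h2 : ((K.factorial : ℝ)) * K.factorial ≤ (2 * K).factorial := by
    rw [two_mul]
    exact_mod_cast Nat.le_of_dvd (Nat.factorial_pos _)
      (Nat.factorial_mul_factorial_dvd_factorial_add K K)
  calc _ ≤ (Real.exp 1 ^ K * K.factorial) * (Real.exp 1 ^ K * K.factorial) := by gcongr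
    _ = Real.exp 1 ^ (2 * K) * ((K.factorial : ℝ) * K.factorial) := by ring
    _ ≤ _ := by gcongr

theorem walkDensity_le {β : ℝ} (hβ : 1 ≤ β) {m n k : ℕ} (hn : 0 < n) (hmn : (m : ℝ) ≤ β * n)
    (c d : Fin (k + 1) → Fin (k + 1)) : walkDensity c d m n ≤ β ^ (k + 1) := by
  set u := (Finset.univ.image c).card with hu
  set v := (Finset.univ.image d).card with hv
  have huv : u + v ≤ edgeCount c d + 1 := card_image_add_card_image_le c d
  have hu' : u ≤ k + 1 := by
    simpa using Finset.card_image_le (s := Finset.univ) (f := c)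
  have hn1 : (1 : ℝ) ≤ n := by exact_mod_cast hn
  have h1 : (kernelCount c m : ℝ) ≤ (β * n) ^ u := by
    calc (kernelCount c m : ℝ) ≤ (m : ℝ) ^ u := by exact_mod_cast kernelCount_le c m
      _ ≤ _ := by gcongr
  have h2 : (kernelCount d n : ℝ) ≤ (n : ℝ) ^ v := by exact_mod_cast kernelCount_le d n
  rw [walkDensity, div_le_iff₀ (by positivity)]
  calc (kernelCount c m : ℝ) * kernelCount d n ≤ (β * n) ^ u * (n : ℝ) ^ v := by gcongr
    _ = β ^ u * (n : ℝ) ^ (u + v) := by rw [mul_pow, pow_add]; ring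
    _ ≤ β ^ (k + 1) * (n : ℝ) ^ (edgeCount c d + 1) := by gcongr

/-- A crude count suffices: each term is at most `(K ^ 2 * β / γ₀) ^ (k + 1)`. The factorial growth
is just what the series of `cosh` can absorb, and the bound is uniform over `γ ≥ γ₀`, including `γ =
n`. -/
theorem modelMoment_le {μ : ℕ → ℝ} (h1 : μ 1 = 0) {K : ℝ} (hK : ∀ k, |μ k| ≤ K ^ k)
    {β γ₀ γ : ℝ} (hβ : 1 ≤ β) (hγ₀ : 0 < γ₀) (hγ₁ : γ₀ ≤ 1) (hγ : γ₀ ≤ γ) {m n : ℕ} (hn : 0 < n)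
    (hmn : (m : ℝ) ≤ β * n) (k : ℕ) :
    modelMoment μ γ m n k ≤
      (Real.exp 1 ^ 2 * K ^ 2 * (1 / γ₀) * β) ^ (k + 1) * (2 * (k + 1)).factorial := by
  have hγp : 0 < γ := hγ₀.trans_le hγ
  have hpow : ∀ e N : ℕ, e ≤ N → γ ^ e / γ ^ N ≤ (1 / γ₀) ^ N := by
    intro e N he
    obtain ⟨w, rfl⟩ := Nat.exists_eq_add_of_le he
    rw [pow_add γ, div_mul_eq_div_div, div_self (by positivity), ← one_div_pow]
    calc (1 / γ) ^ w ≤ (1 / γ₀) ^ w := by gcongr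
      _ ≤ _ := pow_le_pow_right₀ (by rw [le_div_iff₀ hγ₀]; linarith) (by omega)
  have hterm : ∀ c d : Fin (k + 1) → Fin (k + 1),
      fiberProd μ (walkEdge c d) * (γ ^ edgeCount c d / γ ^ (k + 1)) * walkDensity c d m n ≤
        (K ^ 2 * (1 / γ₀) * β) ^ (k + 1) := by
    intro c d
    have hKpos : 0 ≤ K ^ 2 := sq_nonneg K
    have hd0 : 0 ≤ walkDensity c d m n := by rw [walkDensity]; positivity
    by_cases hz : fiberProd μ (walkEdge c d) = 0
    · rw [hz, zero_mul, zero_mul]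
      positivity
    · have he := edgeCount_le_of_fiberProd_ne_zero h1 hz
      have hpow' : γ ^ edgeCount c d / γ ^ (k + 1) ≤ (1 / γ₀) ^ (k + 1) := by
        exact hpow _ _ he
      have hf : fiberProd μ (walkEdge c d) ≤ (K ^ 2) ^ (k + 1) := by
        refine (le_abs_self _).trans ((abs_fiberProd_le hK _).trans (le_of_eq ?_))
        rw [← pow_mul]
        simp [mul_comm]
      rw [mul_pow, mul_pow]
      refine mul_le_mul ?_ (walkDensity_le hβ hn hmn c d) hd0 (by positivity)
      exact mul_le_mul hf hpow' (by positivity) (by positivity)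
  refine (Finset.sum_le_sum fun c _ => Finset.sum_le_sum fun d _ => hterm c d).trans ?_
  simp only [Finset.sum_const, Finset.card_univ, Fintype.card_pi, Fintype.card_fin,
    Finset.prod_const, nsmul_eq_mul]
  have h := pow_self_mul_pow_self_le (k + 1)
  rw [← mul_assoc]
  have hC : 0 ≤ (K ^ 2 * (1 / γ₀) * β) ^ (k + 1) := by positivity
  calc _ ≤ (Real.exp 1 ^ (2 * (k + 1)) * (2 * (k + 1)).factorial) *
        (K ^ 2 * (1 / γ₀) * β) ^ (k + 1) := by
          refine mul_le_mul_of_nonneg_right ?_ hC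
          exact_mod_cast h
    _ = _ := by rw [pow_mul, mul_right_comm, ← mul_pow]; ring_nf

end Moments

/-! ### The expected rate and the trace moments -/

section RateMoments

variable {m n : ℕ} {σ : ℝ}

theorem traceMoment_eq_sum (H : Matrix (Fin m) (Fin n) ℝ) (k : ℕ) :
    traceMoment k H = 1 / (n : ℝ) *
      ∑ i, (Matrix.posSemidef_transpose_mul_self H).isHermitian.eigenvalues i ^ k := by
  rw [traceMoment, Matrix.IsHermitian.trace_pow_eq_sum]

theorem traceMoment_nonneg (H : Matrix (Fin m) (Fin n) ℝ) (k : ℕ) : 0 ≤ traceMoment k H := by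
  rw [traceMoment_eq_sum]
  exact mul_nonneg (by positivity) (Finset.sum_nonneg fun i _ =>
    pow_nonneg ((Matrix.posSemidef_transpose_mul_self H).eigenvalues_nonneg i) k)

/-- The scalar approximation is applied at the singular values `√λ`; the series of `cosh (c * √λ)`
has only even powers, so the error expands in trace moments. -/
theorem abs_mimoRate_sub_sum_le {c ε : ℝ} {p : Polynomial ℝ}
    (hp : ∀ s, |Real.log (1 + 1 / σ ^ 2 * s ^ 2) - p.eval (s ^ 2)| ≤ ε * Real.cosh (c * s))
    (H : Matrix (Fin m) (Fin n) ℝ) : ∃ Φ : ℝ,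
      HasSum (fun k => ε / 2 * (c ^ (2 * k) / ((2 * k).factorial : ℝ) * traceMoment k H)) Φ ∧
      |mimoRate σ H - 1 / 2 * ∑ k ∈ Finset.range (p.natDegree + 1), p.coeff k * traceMoment k H|
        ≤ Φ := by
  set l := (Matrix.posSemidef_transpose_mul_self H).isHermitian.eigenvalues with hl
  have hl0 : ∀ i, 0 ≤ l i := (Matrix.posSemidef_transpose_mul_self H).eigenvalues_nonneg
  refine ⟨ε / 2 * (1 / (n : ℝ) * ∑ i, Real.cosh (c * Real.sqrt (l i))), ?_, ?_⟩
  · refine HasSum.mul_left _ ?_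
    have h : ∀ k, c ^ (2 * k) / ((2 * k).factorial : ℝ) * traceMoment k H =
        1 / (n : ℝ) * ∑ i, (c * Real.sqrt (l i)) ^ (2 * k) / ((2 * k).factorial : ℝ) := by
      intro k
      rw [traceMoment_eq_sum, mul_left_comm, Finset.mul_sum]
      congr 1
      refine Finset.sum_congr rfl fun i _ => ?_
      rw [mul_pow, pow_mul (Real.sqrt _), Real.sq_sqrt (hl0 i)]
      ring
    simp only [h]
    exact (hasSum_sum fun i _ => Real.hasSum_cosh_even (c * Real.sqrt (l i))).mul_left _
  · have h1 : mimoRate σ H = 1 / 2 * (1 / (n : ℝ) * ∑ i, Real.log (1 + 1 / σ ^ 2 * l i)) := by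
      rw [mimoRate, ← mul_assoc]
      congr 1
      rw [one_div, mul_inv, one_div, one_div]
    have h2 : ∑ k ∈ Finset.range (p.natDegree + 1), p.coeff k * traceMoment k H =
        1 / (n : ℝ) * ∑ i, p.eval (l i) := by
      simp only [traceMoment_eq_sum, Polynomial.eval_eq_sum_range, mul_left_comm (p.coeff _),
        ← Finset.mul_sum]
      rw [Finset.sum_comm]
      simp only [Finset.mul_sum, hl]
    rw [h1, h2, ← mul_sub, ← mul_sub, ← Finset.sum_sub_distrib, abs_mul, abs_mul,
      abs_of_nonneg (by positivity : (0 : ℝ) ≤ 1 / 2),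
      abs_of_nonneg (by positivity : (0 : ℝ) ≤ 1 / (n : ℝ))]
    have h3 : |∑ i, (Real.log (1 + 1 / σ ^ 2 * l i) - p.eval (l i))| ≤
        ∑ i, ε * Real.cosh (c * Real.sqrt (l i)) := by
      refine (Finset.abs_sum_le_sum_abs _ _).trans (Finset.sum_le_sum fun i _ => ?_)
      have := hp (Real.sqrt (l i))
      rwa [Real.sq_sqrt (hl0 i)] at this
    rw [← Finset.mul_sum] at h3
    calc _ ≤ 1 / 2 * (1 / (n : ℝ) * (ε * ∑ i, Real.cosh (c * Real.sqrt (l i)))) := by gcongr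
      _ = _ := by ring

/-- Tonelli in the extended nonnegative reals, so integrability of `Φ` need not be known beforehand.
-/
theorem abs_integral_le_of_hasSum {Ω : Type*} [MeasurableSpace Ω] {P : Measure Ω} {g Φ : Ω → ℝ}
    {F : ℕ → Ω → ℝ} {b : ℕ → ℝ} {B : ℝ} (hF0 : ∀ k ω, 0 ≤ F k ω) (hFi : ∀ k, Integrable (F k) P)
    (hΦ : ∀ ω, HasSum (fun k => F k ω) (Φ ω)) (hg : ∀ ω, |g ω| ≤ Φ ω)
    (hb : ∀ k, ∫ ω, F k ω ∂P ≤ b k) (hB : HasSum b B) : |∫ ω, g ω ∂P| ≤ B := by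
  have hb0 : ∀ k, 0 ≤ b k := fun k => (integral_nonneg (hF0 k)).trans (hb k)
  rw [← Real.norm_eq_abs]
  refine (norm_integral_le_lintegral_norm g).trans
    (ENNReal.toReal_le_of_le_ofReal (hB.nonneg hb0) ?_)
  calc ∫⁻ ω, ENNReal.ofReal ‖g ω‖ ∂P ≤ ∫⁻ ω, ∑' k, ENNReal.ofReal (F k ω) ∂P := by
        refine lintegral_mono fun ω => ?_
        rw [← ENNReal.ofReal_tsum_of_nonneg (fun k => hF0 k ω) (hΦ ω).summable, (hΦ ω).tsum_eq]
        exact ENNReal.ofReal_le_ofReal (hg ω)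
    _ = ∑' k, ∫⁻ ω, ENNReal.ofReal (F k ω) ∂P :=
        lintegral_tsum fun k => (hFi k).aestronglyMeasurable.aemeasurable.ennreal_ofReal
    _ ≤ ∑' k, ENNReal.ofReal (b k) := by
        refine ENNReal.tsum_le_tsum fun k => ?_
        rw [← ofReal_integral_eq_lintegral_ofReal (hFi k) (ae_of_all _ (hF0 k))]
        exact ENNReal.ofReal_le_ofReal (hb k)
    _ = ENNReal.ofReal B := by
        rw [← ENNReal.ofReal_tsum_of_nonneg hb0 hB.summable, hB.tsum_eq]

/-- The linear functional on polynomials given by the moments of a model. -/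
noncomputable def modelFunctional (p : Polynomial ℝ) (μ : ℕ → ℝ) (γ : ℝ) (m n : ℕ) : ℝ :=
  1 / 2 * (∑ k ∈ Finset.range p.natDegree, p.coeff (k + 1) * modelMoment μ γ m n k + p.coeff 0)

theorem HasScaledMoments.abs_integral_mimoRate_sub_le {Ω : Type*} [MeasurableSpace Ω]
    {P : Measure Ω} [IsProbabilityMeasure P] {X : Ω → Matrix (Fin m) (Fin n) ℝ} {γ : ℝ}
    {μ : ℕ → ℝ} (h : HasScaledMoments P X γ μ) (hγ : 0 < γ) (hn : 0 < n) (hσ : 0 < σ) {c ε : ℝ}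
    (hε : 0 < ε) {p : Polynomial ℝ}
    (hp : ∀ s, |Real.log (1 + 1 / σ ^ 2 * s ^ 2) - p.eval (s ^ 2)| ≤ ε * Real.cosh (c * s))
    (hM : ∀ k, c ^ (2 * (k + 1)) / ((2 * (k + 1)).factorial : ℝ) * modelMoment μ γ m n k ≤
      (1 / 2) ^ (k + 1)) :
    |∫ ω, mimoRate σ (X ω) ∂P - modelFunctional p μ γ m n| ≤ ε := by
  have hn' : (n : ℝ) ≠ 0 := by exact_mod_cast hn.ne'
  have hT0 : ∫ ω, traceMoment 0 (X ω) ∂P = 1 := by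
    simp [traceMoment, hn']
  have hTi := fun k => h.integrable_traceMoment k
  have hCi : Integrable (fun ω => mimoRate σ (X ω)) P := by
    obtain ⟨K, hK⟩ := h.bounded
    refine integrable_mimoRate hσ h.measurable fun i j => ?_
    refine Integrable.of_bound (C := K ^ 2) ((h.measurable i j).pow_const 2).aestronglyMeasurable
      (ae_of_all _ fun ω => ?_)
    rw [norm_pow]
    exact pow_le_pow_left₀ (norm_nonneg _) (hK ω i j) 2
  have hQ : modelFunctional p μ γ m n = ∫ ω, 1 / 2 * ∑ k ∈ Finset.range (p.natDegree + 1),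
      p.coeff k * traceMoment k (X ω) ∂P := by
    rw [integral_const_mul, integral_finsetSum _ fun k _ => (hTi k).const_mul _]
    simp only [integral_const_mul]
    rw [Finset.sum_range_succ', hT0, mul_one, modelFunctional]
    simp only [h.integral_traceMoment hγ]
  rw [hQ, ← integral_sub hCi ((integrable_finsetSum _ fun k _ => (hTi k).const_mul _).const_mul _)]
  choose Φ hΦ1 hΦ2 using fun ω => abs_mimoRate_sub_sum_le hp (X ω)
  -- The hypothesis `hM` covers positive orders and `hT0` order zero; the geometric series then sums
  -- to `ε`.
  refine abs_integral_le_of_hasSum (b := fun k => ε / 2 * (1 / 2) ^ k) (fun k ω => ?_)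
    (fun k => ((hTi k).const_mul _).const_mul _) hΦ1 hΦ2 (fun k => ?_) ?_
  · have := traceMoment_nonneg (X ω) k
    have hc : 0 ≤ c ^ (2 * k) := by rw [pow_mul]; positivity
    positivity
  · rw [integral_const_mul, integral_const_mul]
    refine mul_le_mul_of_nonneg_left ?_ (by positivity)
    cases k with
    | zero => simp [hT0]
    | succ k => rw [h.integral_traceMoment hγ]; exact hM k
  · have := hasSum_geometric_two.mul_left (ε / 2)
    rwa [div_mul_cancel₀ _ (two_ne_zero)] at this

end RateMoments

/-! ### Truncation -/

section Truncation

variable {Ω : Type*} [MeasurableSpace Ω] {P : Measure Ω}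

/-- Truncate at level `N`, then recentre and rescale so that mean and variance are exact. With `a`,
`q` the first two moments of the truncation, the squared error is `2 - 2 * q / √(q - a ^ 2)`, which
tends to zero by dominated convergence. -/
theorem exists_bounded_standardization [IsProbabilityMeasure P] {Y : Ω → ℝ} (hY : Measurable Y)
    (h1 : ∫ ω, Y ω ∂P = 0) (h2 : ∫ ω, Y ω ^ 2 ∂P = 1) {η : ℝ} (hη : 0 < η) :
    ∃ (τ : ℝ → ℝ) (K : ℝ), Measurable τ ∧ (∀ x, |τ x| ≤ K) ∧ ∫ ω, τ (Y ω) ∂P = 0 ∧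
      ∫ ω, τ (Y ω) ^ 2 ∂P = 1 ∧ ∫ ω, (Y ω - τ (Y ω)) ^ 2 ∂P ≤ η := by
  -- The integral of a non-integrable function is zero by convention, so the value one forces
  -- integrability.
  have hY2 : Integrable (fun ω => Y ω ^ 2) P := by
    by_contra h
    rw [integral_undef h] at h2
    exact zero_ne_one h2
  have hYL : MemLp Y 2 P := (memLp_two_iff_integrable_sq hY.aestronglyMeasurable).2 hY2
  have hY1 : Integrable Y P := hYL.integrable one_le_two
  set t : ℕ → ℝ → ℝ := fun N x => if |x| ≤ N then x else 0 with ht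
  have htm : ∀ N, Measurable (t N) := fun N =>
    Measurable.ite (measurableSet_le measurable_id.abs measurable_const) measurable_id
      measurable_const
  have htb : ∀ N x, |t N x| ≤ N := by
    intro N x
    simp only [ht]
    split_ifs with h
    · exact h
    · simp
  have htx : ∀ N x, |t N x| ≤ |x| := by
    intro N x
    simp only [ht]
    split_ifs with h
    · exact le_rfl
    · simp
  have htlim : ∀ x, Tendsto (fun N => t N x) atTop (𝓝 x) := by
    intro x
    refine tendsto_const_nhds.congr' ?_
    filter_upwards [eventually_ge_atTop ⌈|x|⌉₊] with N hN
    simp only [ht]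
    rw [if_pos (Nat.ceil_le.1 hN)]
  set a : ℕ → ℝ := fun N => ∫ ω, t N (Y ω) ∂P with ha
  set q : ℕ → ℝ := fun N => ∫ ω, t N (Y ω) ^ 2 ∂P with hq
  have hai : ∀ N, Integrable (fun ω => t N (Y ω)) P := fun N =>
    hY1.mono ((htm N).comp hY).aestronglyMeasurable (ae_of_all _ fun ω => htx N _)
  have hqi : ∀ N, Integrable (fun ω => t N (Y ω) ^ 2) P := fun N =>
    hY2.mono (((htm N).comp hY).pow_const 2).aestronglyMeasurable (ae_of_all _ fun ω => by
      rw [norm_pow, norm_pow]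
      exact pow_le_pow_left₀ (norm_nonneg _) (htx N _) 2)
  have halim : Tendsto a atTop (𝓝 0) := by
    rw [← h1]
    refine tendsto_integral_of_dominated_convergence (fun ω => |Y ω|)
      (fun N => (hai N).aestronglyMeasurable) hY1.abs
      (fun N => ae_of_all _ fun ω => htx N _) (ae_of_all _ fun ω => htlim _)
  have hqlim : Tendsto q atTop (𝓝 1) := by
    rw [← h2]
    refine tendsto_integral_of_dominated_convergence (fun ω => Y ω ^ 2)
      (fun N => (hqi N).aestronglyMeasurable) hY2
      (fun N => ae_of_all _ fun ω => ?_) (ae_of_all _ fun ω => (htlim _).pow 2)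
    rw [norm_pow, Real.norm_eq_abs, ← sq_abs (Y ω)]
    exact pow_le_pow_left₀ (abs_nonneg _) (htx N _) 2
  have hvlim : Tendsto (fun N => Real.sqrt (q N - a N ^ 2)) atTop (𝓝 1) := by
    have h := (hqlim.sub (halim.pow 2)).sqrt
    norm_num at h
    exact h
  have hlim : Tendsto (fun N => 2 - 2 * q N / Real.sqrt (q N - a N ^ 2)) atTop (𝓝 0) := by
    have h := ((hqlim.const_mul 2).div hvlim one_ne_zero).const_sub 2
    norm_num at h
    exact h
  obtain ⟨N, hN1, hN2⟩ := ((hlim.eventually (gt_mem_nhds hη)).and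
    (hvlim.eventually (lt_mem_nhds zero_lt_one))).exists
  set v := Real.sqrt (q N - a N ^ 2) with hv
  have hv2 : v ^ 2 = q N - a N ^ 2 := Real.sq_sqrt (Real.sqrt_pos.1 hN2).le
  have hYt : ∀ ω, Y ω * t N (Y ω) = t N (Y ω) ^ 2 := by
    intro ω
    simp only [ht]
    split_ifs <;> ring
  have i1 : Integrable (fun ω => t N (Y ω) ^ 2 - 2 * a N * t N (Y ω)) P :=
    (hqi N).sub ((hai N).const_mul _)
  have i2 : Integrable (fun ω => (t N (Y ω) ^ 2 - 2 * a N * t N (Y ω) + a N ^ 2) / v ^ 2) P :=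
    (i1.add (integrable_const _)).div_const _
  have i3 : Integrable (fun ω => 2 / v * t N (Y ω) ^ 2 - 2 * a N / v * Y ω) P :=
    ((hqi N).const_mul _).sub (hY1.const_mul _)
  have hvar : ∫ ω, (t N (Y ω) ^ 2 - 2 * a N * t N (Y ω) + a N ^ 2) / v ^ 2 ∂P = 1 := by
    rw [integral_div, integral_add i1 (integrable_const _),
      integral_sub (hqi N) ((hai N).const_mul _), integral_const_mul,
      div_eq_one_iff_eq (by positivity), hv2]
    simp only [integral_const, probReal_univ, one_smul]
    change q N - 2 * a N * a N + a N ^ 2 = _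
    ring
  refine ⟨fun x => (t N x - a N) / v, (N + |a N|) / v, ((htm N).sub_const _).div_const _, ?_, ?_,
    ?_, ?_⟩
  · intro x
    rw [abs_div, abs_of_pos hN2]
    gcongr
    exact (abs_sub _ _).trans (add_le_add (htb N x) le_rfl)
  · rw [integral_div, integral_sub (hai N) (integrable_const _)]
    simp [ha]
  · rw [← hvar]
    refine integral_congr_ae (ae_of_all _ fun ω => ?_)
    simp only [div_pow]
    ring
  · have e : ∀ ω, (Y ω - (t N (Y ω) - a N) / v) ^ 2 =
        Y ω ^ 2 + (t N (Y ω) ^ 2 - 2 * a N * t N (Y ω) + a N ^ 2) / v ^ 2 -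
          (2 / v * t N (Y ω) ^ 2 - 2 * a N / v * Y ω) := fun ω => by
      linear_combination (-(2 / v)) * hYt ω
    simp only [e]
    rw [integral_sub (f := fun ω => Y ω ^ 2 +
        (t N (Y ω) ^ 2 - 2 * a N * t N (Y ω) + a N ^ 2) / v ^ 2) (hY2.add i2) i3,
      integral_add hY2 i2, integral_sub ((hqi N).const_mul _) (hY1.const_mul _), hvar, h2]
    simp only [integral_const_mul, h1]
    change 1 + 1 - (2 / v * q N - 2 * a N / v * 0) ≤ η
    rw [show 1 + 1 - (2 / v * q N - 2 * a N / v * 0) = 2 - 2 * q N / v by ring]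
    exact hN1.le

end Truncation

/-! ### Masked arrays -/

section Masks

variable {Ω : Type*} [MeasurableSpace Ω] {P : Measure Ω} {m n : ℕ}

/-- The random weights `ψ` have the mixed moments of independent Bernoulli variables of
parameter `p`, and are independent of `Y`. -/
structure IsMask (P : Measure Ω) (p : ℝ) (Y ψ : Ω → Fin m × Fin n → ℝ) : Prop where
  measurable : ∀ q, Measurable fun ω => ψ ω q
  bounded : ∀ ω q, |ψ ω q| ≤ 1
  moment : ∀ e : Fin m × Fin n → ℕ, ∫ ω, ∏ q, ψ ω q ^ e q ∂P =
    ∏ _q ∈ Finset.univ.filter (fun q => e q ≠ 0), p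
  indep : IndepFun Y ψ P

theorem IsMask.integral_sq {p : ℝ} {Y ψ : Ω → Fin m × Fin n → ℝ} (h : IsMask P p Y ψ)
    (q : Fin m × Fin n) : ∫ ω, ψ ω q ^ 2 ∂P = p := by
  have h1 := h.moment (Pi.single q 2)
  have h2 : Finset.univ.filter (fun q' => (Pi.single q 2 : Fin m × Fin n → ℕ) q' ≠ 0) = {q} := by
    ext q'
    simp [Pi.single_apply]
  rw [h2, Finset.prod_singleton] at h1
  rw [← h1]
  congr 1
  funext ω
  rw [Finset.prod_eq_single q]
  · simp
  · intro q' _ hq'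
    simp [Pi.single_eq_of_ne hq']
  · simp

/-- Brings the dense array into the masked framework, at `γ = n`. -/
theorem IsMask.one [IsProbabilityMeasure P] (Y : Ω → Fin m × Fin n → ℝ) :
    IsMask P 1 Y (fun _ _ => 1) where
  measurable _ := measurable_const
  bounded _ _ := by simp
  moment e := by simp
  indep := indepFun_const_right _ _

theorem IsSparsification.exists_isMask [IsProbabilityMeasure P] {p : ℝ}
    {A S : Ω → Matrix (Fin m) (Fin n) ℝ} (h : IsSparsification P p A S) :
    ∃ ψ : Ω → Fin m × Fin n → ℝ, IsMask P p (fun ω q => A ω q.1 q.2) ψ ∧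
      ∀ ω i j, S ω i j = ψ ω (i, j) * A ω i j := by
  obtain ⟨χ, hχm, hχp, hχi, hind, hS⟩ := h
  have hb : ∀ f : Bool → ℝ, Measurable f := fun f => measurable_from_top
  refine ⟨fun ω q => if χ q.1 q.2 ω = true then 1 else 0, ⟨fun q => ?_, fun ω q => ?_,
    fun e => ?_, ?_⟩, fun ω i j => ?_⟩
  · exact (hb fun b => if b = true then 1 else 0).comp (hχm q.1 q.2)
  · split_ifs <;> simp
  · have h1 := hχi.comp (fun q (b : Bool) => (if b = true then (1 : ℝ) else 0) ^ e q)
      (fun q => hb _)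
    have h2 := h1.integral_fun_prod_eq_prod_integral fun q =>
      ((hb _).comp (hχm q.1 q.2)).aestronglyMeasurable
    simp only [Function.comp_apply] at h2
    rw [h2, Finset.prod_filter]
    refine Finset.prod_congr rfl fun q _ => ?_
    by_cases he : e q = 0
    · simp [he]
    · rw [if_pos he, ← hχp q.1 q.2]
      have hms : MeasurableSet {ω | χ q.1 q.2 ω = true} :=
        hχm q.1 q.2 (measurableSet_singleton true)
      rw [← integral_indicator_one hms]
      congr 1
      funext ω
      by_cases hω : χ q.1 q.2 ω = true
      · simp [hω]
      · simp [hω, he]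
  · exact hind.comp (φ := id) (ψ := fun (c : Fin m × Fin n → Bool) q =>
      if c q = true then (1 : ℝ) else 0) measurable_id
      (measurable_pi_lambda _ fun q => (hb fun b => if b = true then 1 else 0).comp
        (measurable_pi_apply q))
  · rw [hS]
    by_cases hω : χ i j ω = true <;> simp [hω]

variable {A : ℕ → ℕ → Ω → ℝ}

theorem IsStandardType.integral_comp_eq (hA : IsStandardType P A) {f : ℝ → ℝ} (hf : Measurable f)
    (i j : ℕ) : ∫ ω, f (A i j ω) ∂P = ∫ ω, f (A 0 0 ω) ∂P :=
  ((hA.identDistrib i j 0 0).comp hf).integral_eq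

theorem IsStandardType.integrable_sq (hA : IsStandardType P A) (i j : ℕ) :
    Integrable (fun ω => A i j ω ^ 2) P := by
  by_contra h
  have := hA.second_moment i j
  rw [integral_undef h] at this
  exact zero_ne_one this

theorem IsStandardType.hasScaledMoments [IsProbabilityMeasure P] (hA : IsStandardType P A)
    {τ : ℝ → ℝ} (hτ : Measurable τ) {K : ℝ} (hK : ∀ x, |τ x| ≤ K) {γ : ℝ}
    {ψ : Ω → Fin m × Fin n → ℝ} (hψ : IsMask P (γ / n) (fun ω q => corner A m n ω q.1 q.2) ψ) :
    HasScaledMoments P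
      (fun ω => (Real.sqrt γ)⁻¹ • Matrix.of fun i j => ψ ω (i, j) * τ (A i j ω)) γ
      (fun e => ∫ ω, τ (A 0 0 ω) ^ e ∂P) where
  measurable i j := ((hψ.measurable (i, j)).mul (hτ.comp (hA.measurable i j))).const_mul _
  bounded := by
    refine ⟨|(Real.sqrt γ)⁻¹| * (1 * K), fun ω i j => ?_⟩
    simp only [Matrix.smul_apply, Matrix.of_apply, smul_eq_mul, abs_mul]
    exact mul_le_mul_of_nonneg_left
      (mul_le_mul (hψ.bounded _ _) (hK _) (abs_nonneg _) zero_le_one) (abs_nonneg _)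
  moment e := by
    set r := (Real.sqrt γ)⁻¹
    have e1 : ∀ ω, ∏ q : Fin m × Fin n, (r • Matrix.of fun i j : _ => ψ ω (i, j) * τ (A i j ω))
        q.1 q.2 ^ e q = (∏ q : Fin m × Fin n, (r * τ (A q.1 q.2 ω)) ^ e q) *
          ∏ q, ψ ω q ^ e q := by
      intro ω
      rw [← Finset.prod_mul_distrib]
      refine Finset.prod_congr rfl fun q _ => ?_
      simp only [Matrix.smul_apply, Matrix.of_apply, smul_eq_mul]
      ring
    have hind := hψ.indep.comp
      (φ := fun y : Fin m × Fin n → ℝ => ∏ q, (r * τ (y q)) ^ e q)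
      (ψ := fun z : Fin m × Fin n → ℝ => ∏ q, z q ^ e q)
      (Finset.measurable_prod _ fun q _ =>
        ((hτ.comp (measurable_pi_apply q)).const_mul r).pow_const _)
      (Finset.measurable_prod _ fun q _ => (measurable_pi_apply q).pow_const _)
    have h1 := hind.integral_fun_mul_eq_mul_integral
      (Finset.measurable_prod _ fun q _ =>
        ((hτ.comp (hA.measurable q.1 q.2)).const_mul r).pow_const _).aestronglyMeasurable
      (Finset.measurable_prod _ fun q _ => (hψ.measurable q).pow_const _).aestronglyMeasurable
    have hinj : Function.Injective fun q : Fin m × Fin n => ((q.1 : ℕ), (q.2 : ℕ)) := by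
      rintro ⟨a, b⟩ ⟨c, d⟩ hq
      simp only [Prod.mk.injEq, Fin.val_inj] at hq
      exact Prod.ext hq.1 hq.2
    have h2 := ((hA.indep.precomp hinj).comp (fun q x => (r * τ x) ^ e q)
      (fun q => (hτ.const_mul r).pow_const _)).integral_fun_prod_eq_prod_integral fun q =>
        (((hτ.comp (hA.measurable q.1 q.2)).const_mul r).pow_const _).aestronglyMeasurable
    simp only [Function.comp_apply] at h1 h2
    simp only [e1]
    refine h1.trans ?_
    rw [hψ.moment]
    refine (congrArg (· * _) h2).trans ?_
    have h3 : ∀ q : Fin m × Fin n, ∫ ω, (r * τ (A q.1 q.2 ω)) ^ e q ∂P =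
        r ^ e q * ∫ ω, τ (A 0 0 ω) ^ e q ∂P := by
      intro q
      simp only [mul_pow]
      rw [integral_const_mul, hA.integral_comp_eq (hτ.pow_const (e q))]
    simp only [h3]
    rw [Finset.prod_filter, Finset.prod_filter, ← Finset.prod_mul_distrib]
    refine Finset.prod_congr rfl fun q _ => ?_
    by_cases he : e q = 0
    · simp [he]
    · rw [if_pos he, if_pos he]
      ring

theorem integrable_mask_mul_sq [IsProbabilityMeasure P] {p : ℝ} {Y ψ : Ω → Fin m × Fin n → ℝ}
    (hψ : IsMask P p Y ψ) {Z : Ω → ℝ} (hZ : Measurable Z) (hZ2 : Integrable (fun ω => Z ω ^ 2) P)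
    (r : ℝ) (q : Fin m × Fin n) : Integrable (fun ω => (r * (ψ ω q * Z ω)) ^ 2) P := by
  refine (hZ2.const_mul (r ^ 2)).mono'
    ((((hψ.measurable q).mul hZ).const_mul r).pow_const 2).aestronglyMeasurable
    (ae_of_all _ fun ω => ?_)
  rw [Real.norm_of_nonneg (sq_nonneg _), mul_pow, mul_pow, ← sq_abs (ψ ω q)]
  refine mul_le_mul_of_nonneg_left ?_ (sq_nonneg r)
  exact mul_le_of_le_one_left (sq_nonneg _) (pow_le_one₀ (abs_nonneg _) (hψ.bounded ω q))

theorem IsStandardType.integrable_mimoRate_mask [IsProbabilityMeasure P] (hA : IsStandardType P A)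
    {σ p : ℝ} (hσ : 0 < σ) {ψ : Ω → Fin m × Fin n → ℝ}
    (hψ : IsMask P p (fun ω q => corner A m n ω q.1 q.2) ψ) (r : ℝ) :
    Integrable (fun ω => mimoRate σ (r • Matrix.of fun (i : Fin m) (j : Fin n) =>
      ψ ω (i, j) * A i j ω)) P :=
  integrable_mimoRate hσ
    (fun i j => ((hψ.measurable (i, j)).mul (hA.measurable i j)).const_mul r)
    (fun i j => integrable_mask_mul_sq hψ (hA.measurable i j) (hA.integrable_sq i j) r (i, j))

/-- The factor `1 / γ` from the scaling cancels the keep probability `γ / n`, so each entry has mean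
square error at most `η / n`; the bound is therefore free of `γ`. -/
theorem IsStandardType.abs_integral_mimoRate_sub_truncation_le [IsProbabilityMeasure P]
    (hA : IsStandardType P A) {σ : ℝ} (hσ : 0 < σ) {τ : ℝ → ℝ} (hτ : Measurable τ) {K : ℝ}
    (hK : ∀ x, |τ x| ≤ K) {γ η θ β : ℝ} (hγ : 0 < γ) (hθ : 0 < θ) (hn : 0 < n)
    (hmn : (m : ℝ) ≤ β * n) (hη : ∫ ω, (A 0 0 ω - τ (A 0 0 ω)) ^ 2 ∂P ≤ η)
    {ψ : Ω → Fin m × Fin n → ℝ} (hψ : IsMask P (γ / n) (fun ω q => corner A m n ω q.1 q.2) ψ) :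
    |∫ ω, mimoRate σ ((Real.sqrt γ)⁻¹ • Matrix.of fun (i : Fin m) (j : Fin n) =>
        ψ ω (i, j) * A i j ω) ∂P -
      ∫ ω, mimoRate σ ((Real.sqrt γ)⁻¹ • Matrix.of fun (i : Fin m) (j : Fin n) =>
        ψ ω (i, j) * τ (A i j ω)) ∂P| ≤ θ / 2 + (1 + 1 / θ) / (2 * σ ^ 2) * (β * η) := by
  set r := (Real.sqrt γ)⁻¹ with hr
  have hn' : (0 : ℝ) < n := by exact_mod_cast hn
  have hη0 : 0 ≤ η := (integral_nonneg fun ω => sq_nonneg _).trans hη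
  have hτ2 : ∀ i j, Integrable (fun ω => τ (A i j ω) ^ 2) P := fun i j => by
    refine Integrable.of_bound (C := K ^ 2)
      ((hτ.comp (hA.measurable i j)).pow_const 2).aestronglyMeasurable (ae_of_all _ fun ω => ?_)
    rw [norm_pow]
    exact pow_le_pow_left₀ (norm_nonneg _) (hK _) 2
  have hdm : ∀ i j, Measurable fun ω => A i j ω - τ (A i j ω) := fun i j =>
    (hA.measurable i j).sub (hτ.comp (hA.measurable i j))
  have hd2 : ∀ i j, Integrable (fun ω => (A i j ω - τ (A i j ω)) ^ 2) P := fun i j =>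
    (((memLp_two_iff_integrable_sq (hA.measurable i j).aestronglyMeasurable).2
      (hA.integrable_sq i j)).sub ((memLp_two_iff_integrable_sq
        (hτ.comp (hA.measurable i j)).aestronglyMeasurable).2 (hτ2 i j))).integrable_sq
  have hI1 := hA.integrable_mimoRate_mask hσ hψ r
  have hI2 : Integrable (fun ω => mimoRate σ (r • Matrix.of fun (i : Fin m) (j : Fin n) =>
      ψ ω (i, j) * τ (A i j ω))) P :=
    integrable_mimoRate hσ
      (fun i j => ((hψ.measurable (i, j)).mul (hτ.comp (hA.measurable i j))).const_mul r)
      (fun i j => integrable_mask_mul_sq hψ (hτ.comp (hA.measurable i j)) (hτ2 i j) r (i, j))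
  have hentry : ∀ (i : Fin m) (j : Fin n),
      ∫ ω, (r * (ψ ω (i, j) * (A i j ω - τ (A i j ω)))) ^ 2 ∂P ≤ η / n := by
    intro i j
    have hev : Measurable fun z : Fin m × Fin n → ℝ => z (i, j) := measurable_pi_apply (i, j)
    have hind := hψ.indep.comp (φ := fun y : Fin m × Fin n → ℝ => (y (i, j) - τ (y (i, j))) ^ 2)
      (ψ := fun z : Fin m × Fin n → ℝ => z (i, j) ^ 2)
      ((hev.sub (hτ.comp hev)).pow_const 2) (hev.pow_const 2)
    have h1 := hind.integral_fun_mul_eq_mul_integral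
      ((hdm i j).pow_const 2).aestronglyMeasurable
      ((hψ.measurable (i, j)).pow_const 2).aestronglyMeasurable
    simp only [Function.comp_apply] at h1
    have h2 : ∫ ω, (A i j ω - τ (A i j ω)) ^ 2 ∂P ≤ η := by
      rw [hA.integral_comp_eq (f := fun x => (x - τ x) ^ 2) ((measurable_id.sub hτ).pow_const 2)]
      exact hη
    have e : ∀ ω, (r * (ψ ω (i, j) * (A i j ω - τ (A i j ω)))) ^ 2 =
        r ^ 2 * ((A i j ω - τ (A i j ω)) ^ 2 * ψ ω (i, j) ^ 2) := fun ω => by ring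
    simp only [e]
    rw [integral_const_mul]
    refine (le_of_eq (congrArg (r ^ 2 * ·) h1)).trans ?_
    rw [hψ.integral_sq]
    have hr2 : r ^ 2 = γ⁻¹ := by rw [hr, inv_pow, Real.sq_sqrt hγ.le]
    rw [hr2]
    calc γ⁻¹ * ((∫ ω, (A i j ω - τ (A i j ω)) ^ 2 ∂P) * (γ / n)) ≤ γ⁻¹ * (η * (γ / n)) := by gcongr
      _ = η / n := by field_simp
  have hDi : ∀ (i : Fin m) (j : Fin n),
      Integrable (fun ω => (r * (ψ ω (i, j) * (A i j ω - τ (A i j ω)))) ^ 2) P := fun i j =>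
    integrable_mask_mul_sq hψ (hdm i j) (hd2 i j) r (i, j)
  have hDs : Integrable (fun ω => ∑ i : Fin m, ∑ j : Fin n,
      (r * (ψ ω (i, j) * (A i j ω - τ (A i j ω)))) ^ 2) P :=
    integrable_finsetSum _ fun i _ => integrable_finsetSum _ fun j _ => hDi i j
  rw [← integral_sub hI1 hI2]
  refine (abs_integral_le_integral_abs).trans ?_
  have hpt : ∀ ω, |mimoRate σ (r • Matrix.of fun (i : Fin m) (j : Fin n) =>
        ψ ω (i, j) * A i j ω) -
      mimoRate σ (r • Matrix.of fun (i : Fin m) (j : Fin n) => ψ ω (i, j) * τ (A i j ω))| ≤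
      θ / 2 + (1 + 1 / θ) / (2 * σ ^ 2) * (1 / (n : ℝ) * ∑ i : Fin m, ∑ j : Fin n,
        (r * (ψ ω (i, j) * (A i j ω - τ (A i j ω)))) ^ 2) := by
    intro ω
    refine (abs_mimoRate_sub_le hσ hθ _ _).trans (le_of_eq ?_)
    simp only [Matrix.smul_apply, Matrix.of_apply, smul_eq_mul, mul_sub]
  refine (integral_mono (hI1.sub hI2).abs
    (g := fun ω => θ / 2 + (1 + 1 / θ) / (2 * σ ^ 2) * (1 / (n : ℝ) * ∑ i : Fin m, ∑ j : Fin n,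
      (r * (ψ ω (i, j) * (A i j ω - τ (A i j ω)))) ^ 2))
    ((integrable_const _).add ((hDs.const_mul _).const_mul _)) hpt).trans ?_
  rw [integral_add (integrable_const _) ((hDs.const_mul _).const_mul _), integral_const_mul,
    integral_const_mul, integral_finsetSum _ fun i _ => integrable_finsetSum _ fun j _ => hDi i j]
  simp only [integral_const, probReal_univ, one_smul]
  have hsum : ∑ i : Fin m, ∫ ω, ∑ j : Fin n,
      (r * (ψ ω (i, j) * (A i j ω - τ (A i j ω)))) ^ 2 ∂P ≤ m * η := by
    calc _ ≤ ∑ _i : Fin m, η := by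
          refine Finset.sum_le_sum fun i _ => ?_
          rw [integral_finsetSum _ fun j _ => hDi i j]
          refine (Finset.sum_le_sum fun j _ => hentry i j).trans (le_of_eq ?_)
          simp only [Finset.sum_const, Finset.card_univ, Fintype.card_fin, nsmul_eq_mul]
          field_simp
      _ = m * η := by simp
  have hfin : 1 / (n : ℝ) * ∑ i : Fin m, ∫ ω, ∑ j : Fin n,
      (r * (ψ ω (i, j) * (A i j ω - τ (A i j ω)))) ^ 2 ∂P ≤ β * η := by
    calc _ ≤ 1 / (n : ℝ) * ((β * n) * η) := by
          refine mul_le_mul_of_nonneg_left (hsum.trans ?_) (by positivity)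
          gcongr
      _ = β * η := by field_simp
  gcongr

/-- Comparison of the expected rate of a masked array with a combination of model moments. -/
theorem IsStandardType.abs_integral_mimoRate_mask_sub_le [IsProbabilityMeasure P]
    (hA : IsStandardType P A) {σ : ℝ} (hσ : 0 < σ) {τ : ℝ → ℝ} (hτ : Measurable τ) {K : ℝ}
    (hK : ∀ x, |τ x| ≤ K) (hτ1 : ∫ ω, τ (A 0 0 ω) ∂P = 0) {c ε η θ β γ₀ γ : ℝ} (hε : 0 < ε)
    (hθ : 0 < θ) (hβ : 1 ≤ β) (hγ₀ : 0 < γ₀) (hγ₁ : γ₀ ≤ 1) (hγ : γ₀ ≤ γ) (hn : 0 < n)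
    (hmn : (m : ℝ) ≤ β * n) (hη : ∫ ω, (A 0 0 ω - τ (A 0 0 ω)) ^ 2 ∂P ≤ η)
    (hc : c ^ 2 * (Real.exp 1 ^ 2 * K ^ 2 * (1 / γ₀) * β) ≤ 1 / 2) {p : Polynomial ℝ}
    (hp : ∀ s, |Real.log (1 + 1 / σ ^ 2 * s ^ 2) - p.eval (s ^ 2)| ≤ ε * Real.cosh (c * s))
    {ψ : Ω → Fin m × Fin n → ℝ} (hψ : IsMask P (γ / n) (fun ω q => corner A m n ω q.1 q.2) ψ) :
    |∫ ω, mimoRate σ ((Real.sqrt γ)⁻¹ • Matrix.of fun (i : Fin m) (j : Fin n) =>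
        ψ ω (i, j) * A i j ω) ∂P - modelFunctional p (fun e => ∫ ω, τ (A 0 0 ω) ^ e ∂P) γ m n| ≤
      θ / 2 + (1 + 1 / θ) / (2 * σ ^ 2) * (β * η) + ε := by
  have hγp : 0 < γ := hγ₀.trans_le hγ
  have h1 := hA.abs_integral_mimoRate_sub_truncation_le hσ hτ hK hγp hθ hn hmn hη hψ
  have h2 := (hA.hasScaledMoments hτ hK hψ).abs_integral_mimoRate_sub_le hγp hn hσ hε hp ?_
  · exact (abs_sub_le _ _ _).trans (add_le_add h1 h2)
  · intro k
    have hμ : ∀ e, |∫ ω, τ (A 0 0 ω) ^ e ∂P| ≤ K ^ e := by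
      intro e
      have := norm_integral_le_of_norm_le_const (μ := P) (f := fun ω => τ (A 0 0 ω) ^ e)
        (C := K ^ e) (ae_of_all _ fun ω => by
          rw [norm_pow]; exact pow_le_pow_left₀ (norm_nonneg _) (hK _) e)
      simpa using this
    have hb := modelMoment_le (μ := fun e => ∫ ω, τ (A 0 0 ω) ^ e ∂P) (by simpa using hτ1) hμ hβ
      hγ₀ hγ₁ hγ hn hmn k
    set C := Real.exp 1 ^ 2 * K ^ 2 * (1 / γ₀) * β
    have hc0 : 0 ≤ c ^ (2 * (k + 1)) := by rw [pow_mul]; positivity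
    have hC0 : 0 ≤ C := by positivity
    -- The factorial of the `cosh` series cancels that of the moment bound.
    calc _ ≤ c ^ (2 * (k + 1)) / ((2 * (k + 1)).factorial : ℝ) *
          (C ^ (k + 1) * (2 * (k + 1)).factorial) := by gcongr
      _ = (c ^ 2 * C) ^ (k + 1) := by
          rw [mul_pow (c ^ 2) C, ← pow_mul]
          field_simp
      _ ≤ _ := by gcongr

end Masks

/-! ### The limit -/

theorem tendsto_modelFunctional {m : ℕ → ℕ} {α : ℝ} (hα : 0 < α)
    (hm : Tendsto (fun n : ℕ => (m n : ℝ) / (n : ℝ)) atTop (𝓝 α)) (p : Polynomial ℝ)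
    {μ ν : ℕ → ℝ} (hμ1 : μ 1 = 0) (hμ2 : μ 2 = 1) (hν1 : ν 1 = 0) (hν2 : ν 2 = 1) :
    ∃ V : ℝ → ℝ, (∀ γ, Tendsto (fun n : ℕ =>
      modelFunctional p μ γ (m n) n - modelFunctional p ν n (m n) n) atTop (𝓝 (V γ))) ∧
      Tendsto V atTop (𝓝 0) := by
  choose U hU1 hU2 using modelMoment_limits hα hm
  choose V hV1 hV2 using fun k => hU2 k μ hμ1 hμ2
  refine ⟨fun γ => 1 / 2 * (∑ k ∈ Finset.range p.natDegree, p.coeff (k + 1) * V k γ + p.coeff 0) -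
    1 / 2 * (∑ k ∈ Finset.range p.natDegree, p.coeff (k + 1) * U k + p.coeff 0),
    fun γ => ?_, ?_⟩
  · exact (((tendsto_finsetSum _ fun k _ => (hV1 k γ).const_mul _).add_const _).const_mul _).sub
      (((tendsto_finsetSum _ fun k _ => (hU1 k ν hν1 hν2).const_mul _).add_const _).const_mul _)
  · rw [← sub_self (1 / 2 * (∑ k ∈ Finset.range p.natDegree, p.coeff (k + 1) * U k + p.coeff 0))]
    exact (((tendsto_finsetSum _ fun k _ => (hV2 k).const_mul _).add_const _).const_mul _).sub_const
      _

/-- A double sequence that is uniformly close to double sequences with vanishing iterated limits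
has a vanishing iterated limit. -/
theorem exists_iterated_limit {F : ℝ → ℕ → ℝ}
    (h : ∀ ε > 0, ∀ γ₀ > 0, ∃ (Q : ℝ → ℕ → ℝ) (V : ℝ → ℝ),
      (∀ γ, Tendsto (Q γ) atTop (𝓝 (V γ))) ∧ Tendsto V atTop (𝓝 0) ∧
        ∀ γ ≥ γ₀, ∀ᶠ n in atTop, |F γ n - Q γ n| ≤ ε) :
    ∃ L : ℝ → ℝ, (∀ γ : ℝ, 0 < γ → Tendsto (F γ) atTop (𝓝 (L γ))) ∧ Tendsto L atTop (𝓝 0) := by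
  have hlim : ∀ γ : ℝ, ∃ l, 0 < γ → Tendsto (F γ) atTop (𝓝 l) := by
    intro γ
    by_cases hγ : 0 < γ
    · have hc : CauchySeq (F γ) := by
        rw [Metric.cauchySeq_iff']
        intro ε hε
        -- The threshold is `γ` itself. Four errors of size `ε / 8` separate `F γ n` from `F γ N`,
        -- through `Q` and `V γ`.
        obtain ⟨Q, V, hQ, -, hF⟩ := h (ε / 8) (by positivity) γ hγ
        obtain ⟨N, hN⟩ := eventually_atTop.1 ((hF γ le_rfl).and
          ((hQ γ).eventually (Metric.ball_mem_nhds _ (show 0 < ε / 8 by positivity))))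
        refine ⟨N, fun n hn => ?_⟩
        obtain ⟨a1, a2⟩ := hN n hn
        obtain ⟨b1, b2⟩ := hN N le_rfl
        rw [Real.dist_eq] at a2 b2 ⊢
        rw [abs_le] at a1 b1
        rw [abs_lt] at a2 b2 ⊢
        constructor <;> linarith [a1.1, a1.2, b1.1, b1.2, a2.1, a2.2, b2.1, b2.2]
      obtain ⟨l, hl⟩ := cauchySeq_tendsto_of_complete hc
      exact ⟨l, fun _ => hl⟩
    · exact ⟨0, fun h' => absurd h' hγ⟩
  choose L hL using hlim
  refine ⟨L, hL, ?_⟩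
  rw [Metric.tendsto_nhds]
  intro ε hε
  obtain ⟨Q, V, hQ, hV, hF⟩ := h (ε / 2) (by positivity) 1 one_pos
  filter_upwards [eventually_ge_atTop 1,
    hV.eventually (Metric.ball_mem_nhds _ (show 0 < ε / 2 by positivity))] with γ hγ hVγ
  have h1 : |L γ - V γ| ≤ ε / 2 :=
    le_of_tendsto ((hL γ (one_pos.trans_le hγ)).sub (hQ γ)).abs (hF γ hγ)
  rw [Real.dist_eq, sub_zero] at hVγ ⊢
  have := abs_sub_le (L γ) (V γ) 0
  simp only [sub_zero] at this
  linarith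

theorem mainTheorem6
    {Ω : Type*} [MeasurableSpace Ω] (P : Measure Ω) [IsProbabilityMeasure P]
    {Ω' : Type*} [MeasurableSpace Ω'] (P' : Measure Ω') [IsProbabilityMeasure P']
    (A : ℕ → ℕ → Ω → ℝ) (hA : IsStandardType P A)
    (B : ℕ → ℕ → Ω' → ℝ) (hB : IsStandardType P' B)
    (σ : ℝ) (hσ : 0 < σ) (α : ℝ) (hα : 0 < α)
    (m : ℕ → ℕ) (hm : Tendsto (fun n : ℕ => (m n : ℝ) / (n : ℝ)) atTop (𝓝 α))
    (S : ℝ → (n : ℕ) → Ω → Matrix (Fin (m n)) (Fin n) ℝ)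
    (hS : ∀ γ : ℝ, 0 < γ → ∀ n : ℕ, γ ≤ (n : ℝ) →
      IsSparsification P (γ / (n : ℝ)) (corner A (m n) n) (S γ n)) :
    (∀ γ : ℝ, 0 < γ → ∀ n : ℕ, γ ≤ (n : ℝ) →
      Integrable (fun ω => mimoRate σ ((Real.sqrt γ)⁻¹ • S γ n ω)) P) ∧
    (∀ n : ℕ, Integrable
      (fun ω => mimoRate σ ((Real.sqrt (n : ℝ))⁻¹ • corner B (m n) n ω)) P') ∧
    ∃ L : ℝ → ℝ,
      (∀ γ : ℝ, 0 < γ →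
        Tendsto (fun n : ℕ =>
            (∫ ω, mimoRate σ ((Real.sqrt γ)⁻¹ • S γ n ω) ∂P) -
              ∫ ω, mimoRate σ ((Real.sqrt (n : ℝ))⁻¹ • corner B (m n) n ω) ∂P')
          atTop (𝓝 (L γ))) ∧
      Tendsto L atTop (𝓝 0) := by
  have hmask : ∀ γ : ℝ, 0 < γ → ∀ n : ℕ, γ ≤ (n : ℝ) → ∃ ψ : Ω → Fin (m n) × Fin n → ℝ,
      IsMask P (γ / n) (fun ω q => corner A (m n) n ω q.1 q.2) ψ ∧ ∀ ω,
        S γ n ω = Matrix.of fun (i : Fin (m n)) (j : Fin n) => ψ ω (i, j) * A i j ω := by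
    intro γ hγ n hn
    obtain ⟨ψ, hψ, hS'⟩ := (hS γ hγ n hn).exists_isMask
    exact ⟨ψ, hψ, fun ω => Matrix.ext fun i j => hS' ω i j⟩
  have hcorner : ∀ n ω, corner B (m n) n ω =
      Matrix.of fun (i : Fin (m n)) (j : Fin n) => (1 : ℝ) * B i j ω := by
    intro n ω
    ext i j
    simp [corner]
  refine ⟨fun γ hγ n hn => ?_, fun n => ?_, exists_iterated_limit fun ε hε γ₁ hγ₁ => ?_⟩
  · obtain ⟨ψ, hψ, hS'⟩ := hmask γ hγ n hn
    simp only [hS']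
    exact hA.integrable_mimoRate_mask hσ hψ _
  · simp only [hcorner]
    exact hB.integrable_mimoRate_mask hσ (IsMask.one _) _
  · set γ₀ := min γ₁ 1 with hγ₀d
    have hγ₀ : 0 < γ₀ := lt_min hγ₁ one_pos
    set β := α + 1 with hβd
    have hβ : 1 ≤ β := by linarith
    set θ := ε / 3 with hθd
    have hθ : 0 < θ := by positivity
    -- Makes the second truncation term equal to `θ / 2`, so each model costs `θ + ε / 6 = ε / 2`.
    set η := θ * σ ^ 2 / ((1 + 1 / θ) * β) with hηd
    have hη : 0 < η := by positivity
    have hbound : θ / 2 + (1 + 1 / θ) / (2 * σ ^ 2) * (β * η) + ε / 6 = ε / 2 := by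
      have : (1 + 1 / θ) / (2 * σ ^ 2) * (β * η) = θ / 2 := by
        rw [hηd]
        have h1 : (1 + 1 / θ) ≠ 0 := by positivity
        have h2 : β ≠ 0 := by positivity
        generalize 1 + 1 / θ = x at *
        field_simp
      rw [this]
      ring
    obtain ⟨τ, K, hτ, hK, hτ1, hτ2, hτη⟩ := exists_bounded_standardization (hA.measurable 0 0)
      (hA.mean 0 0) (hA.second_moment 0 0) hη
    obtain ⟨τ', K', hτ', hK', hτ1', hτ2', hτη'⟩ := exists_bounded_standardization
      (hB.measurable 0 0) (hB.mean 0 0) (hB.second_moment 0 0) hη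
    -- A common bound for both truncations gives one `c`, hence a single polynomial `p` for both
    -- models; otherwise the limiting moments would not cancel.
    set R := max K K' with hR
    set C := Real.exp 1 ^ 2 * R ^ 2 * (1 / γ₀) * β with hC
    have hC0 : 0 ≤ C := by positivity
    set c := Real.sqrt (1 / (2 * (C + 1))) with hcd
    have hcpos : 0 < c := Real.sqrt_pos.2 (by positivity)
    have hc : c ^ 2 * C ≤ 1 / 2 := by
      rw [hcd, Real.sq_sqrt (by positivity), div_mul_eq_mul_div, div_le_iff₀ (by positivity)]
      linarith
    obtain ⟨p, hp⟩ := coshApproximable_log_one_add hcpos hσ (ε / 6) (by positivity)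
    obtain ⟨V, hV1, hV2⟩ := tendsto_modelFunctional hα hm p
      (μ := fun e => ∫ ω, τ (A 0 0 ω) ^ e ∂P) (ν := fun e => ∫ ω, τ' (B 0 0 ω) ^ e ∂P')
      (by simpa using hτ1) hτ2 (by simpa using hτ1') hτ2'
    refine ⟨_, V, hV1, hV2, fun γ hγ => ?_⟩
    have hγ' : γ₀ ≤ γ := (min_le_left _ _).trans hγ
    filter_upwards [eventually_gt_atTop 0, hm.eventually (gt_mem_nhds (lt_add_one α)),
      eventually_ge_atTop ⌈γ⌉₊] with n hn hmn hγn
    have hn' : (0 : ℝ) < n := by exact_mod_cast hn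
    have hmn' : (m n : ℝ) ≤ β * n := by
      rw [div_lt_iff₀ hn'] at hmn
      exact hmn.le
    obtain ⟨ψ, hψ, hS'⟩ := hmask γ (hγ₀.trans_le hγ') n (Nat.ceil_le.1 hγn)
    have h1 := hA.abs_integral_mimoRate_mask_sub_le hσ hτ
      (fun x => (hK x).trans (le_max_left K K')) hτ1 (show 0 < ε / 6 by positivity) hθ hβ hγ₀
      (min_le_right _ _) hγ' hn hmn' hτη hc hp hψ
    have hone : IsMask P' ((n : ℝ) / n) (fun ω q => corner B (m n) n ω q.1 q.2)
        (fun _ _ => (1 : ℝ)) := by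
      rw [div_self hn'.ne']
      exact IsMask.one _
    -- The dense model is treated with `γ = n`, which is admissible because `γ₀ ≤ 1 ≤ n`.
    have hn1 : γ₀ ≤ (n : ℝ) := (min_le_right _ _).trans (by exact_mod_cast hn)
    have h2 := hB.abs_integral_mimoRate_mask_sub_le hσ hτ'
      (fun x => (hK' x).trans (le_max_right K K')) hτ1' (show 0 < ε / 6 by positivity) hθ hβ hγ₀
      (min_le_right _ _) hn1 hn hmn' hτη' hc hp hone
    simp only [← hS'] at h1
    simp only [← hcorner] at h2
    rw [hbound, abs_le] at h1 h2
    rw [abs_le]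
    constructor <;> linarith [h1.1, h1.2, h2.1, h2.2]
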